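/- **Conventions.** Manifolds are smooth, Hausdorff, second countable, finite-dimensional and without boundary. A *contact manifold* $(M,H)$ is a manifold $M$ with a hyperplane distribution $H\subseteq TM$ whose curvature $\kappa_H:\wedge^2H\to TM/H$, $(X,Y)\mapsto [X,Y]\bmod H$, is non-degenerate. A *contactomorphism* $(M_1,H_1)\to(M_2,H_2)$ is a diffeomorphism $M_1\to M_2$ identifying $H_1$ and $H_2$. Let $L\to M$ be a real line bundle. A *derivation* of $L$ is an $\mathbb R$-linear operator $D:\Gamma(L)\to\Gamma(L)$ such that $D(fe)=X(f)e+fD(e)$ for some (necessarily unique) vector field $X=\sigma(D)$, its *symbol*. Derivations are the sections of the gauge algebroid $\mathsf DL\to M$, with bracket the commutator and anchor the symbol $\sigma:\mathsf DL\to TM$. The identity operator is a derivation, denoted $\mathbb I$. An *Atiyah $k$-form* is a smooth alternating $k$-linear bundle map $\wedge^k\mathsf DL\to L$. The Lie algebroid differential $d_{\mathsf D}$ is given on 1-forms and 2-forms by $$d_{\mathsf D}\Theta(D_1,D_2)=D_1(\Theta(D_2))-D_2(\Theta(D_1))-\Theta([D_1,D_2]),$$ $$d_{\mathsf D}\omega(D_1,D_2,D_3)=D_1(\omega(D_2,D_3))-D_2(\omega(D_1,D_3))+D_3(\omega(D_1,D_2))-\omega([D_1,D_2],D_3)+\omega([D_1,D_3],D_2)-\omega([D_2,D_3],D_1).$$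 A *symplectic Atiyah form* on $L$ is an Atiyah 2-form $\omega$ with $d_{\mathsf D}\omega=0$ such that $\mathsf DL\to\mathrm{Hom}(\mathsf DL,L)$, $D\mapsto\omega(D,-)$, is an isomorphism. A *symplectic Atiyah bundle* $(L\to M,\omega)$ is a line bundle with a symplectic Atiyah form. A *symplectic Atiyah morphism* $(L_1,\omega_1)\to(L_2,\omega_2)$ is a vector bundle isomorphism $L_1\cong L_2$, covering a diffeomorphism of the bases, whose induced isomorphism $\mathsf DL_1\cong\mathsf DL_2$ identifies $\omega_1$ and $\omega_2$. **Theorem.** The category of contact manifolds and contactomorphisms is equivalent to the category of symplectic Atiyah bundles and symplectic Atiyah morphisms. More precisely, there is an equivalence of categories which, up to natural diffeomorphisms of the base manifolds, is given as follows. 1. It sends a contact manifold $(M,H)$ to $(L\to M,\omega)$, where $L\cong TM/H$ is the normal bundle, i.e. there is an $L$-valued 1-form $\theta_H:TM\to L$ that is fibrewise surjective with kernel $H$, and $\omega=d_{\mathsf D}(\theta_H\circ\sigma)$. It sends a contactomorphism to the bundle isomorphism over it that is induced by its differential on the normal bundles. 2. Its quasi-inverse sends a symplectic Atiyah bundle $(L\to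 M,\omega)$ to $(M,\ker\theta)$, where $\theta:TM\to L$ is the unique $L$-valued 1-form with $\theta\circ\sigma=\iota_{\mathbb I}\omega=\omega(\mathbb I,-)$; moreover $\omega=d_{\mathsf D}(\theta\circ\sigma)$. It sends a symplectic Atiyah morphism to the underlying diffeomorphism of the bases. -/

import Mathlib

open scoped Manifold ContDiff Bundle
open CategoryTheory

noncomputable section

namespace AtiyahContact

universe u v

/-! ### Smooth manifolds, vector fields, line bundles -/

/-- A smooth manifold: Hausdorff, second countable, without boundary, of some finite dimension. -/
structure SmoothManifold : Type (u + 1) where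
  dim : ℕ
  carrier : Type u
  [top : TopologicalSpace carrier]
  [charted : ChartedSpace (EuclideanSpace ℝ (Fin dim)) carrier]
  [isManifold : IsManifold (𝓡 dim) ∞ carrier]
  [t2 : T2Space carrier]
  [secondCountable : SecondCountableTopology carrier]

instance : CoeSort SmoothManifold.{u} (Type u) := ⟨SmoothManifold.carrier⟩

attribute [instance] SmoothManifold.top SmoothManifold.charted SmoothManifold.isManifold
  SmoothManifold.t2 SmoothManifold.secondCountable

/-- The tangent space `T_x M`. -/
abbrev SmoothManifold.Tangent (M : SmoothManifold.{u}) (x : M) : Type :=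
  TangentSpace (𝓡 M.dim) x

/-- Smooth real functions on `M`. -/
abbrev SmoothManifold.Func (M : SmoothManifold.{u}) : Type u :=
  C^∞⟮𝓡 M.dim, M; 𝓘(ℝ, ℝ), ℝ⟯

/-- Smooth vector fields on `M`. -/
abbrev SmoothManifold.VField (M : SmoothManifold.{u}) : Type u :=
  Cₛ^∞⟮𝓡 M.dim; EuclideanSpace ℝ (Fin M.dim), (TangentSpace (𝓡 M.dim) : M → Type)⟯

/-- Diffeomorphisms `M → N`. -/
abbrev Diffeo (M N : SmoothManifold.{u}) : Type u := M ≃ₘ^∞⟮𝓡 M.dim, 𝓡 N.dim⟯ N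

/-- The differential `T_x M → T_{φ x} N` of a diffeomorphism. -/
def Diffeo.d {M N : SmoothManifold.{u}} (φ : Diffeo M N) (x : M) :
    M.Tangent x →ₗ[ℝ] N.Tangent (φ x) :=
  (mfderiv (𝓡 M.dim) (𝓡 N.dim) φ x).toLinearMap

/-- A smooth real line bundle over `M`. -/
structure LineBundle (M : SmoothManifold.{u}) : Type (max u (v + 1)) where
  fibre : M → Type v
  [addCommGroup : ∀ x, AddCommGroup (fibre x)]
  [module : ∀ x, Module ℝ (fibre x)]
  [topFibre : ∀ x, TopologicalSpace (fibre x)]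
  [topTotal : TopologicalSpace (Bundle.TotalSpace ℝ fibre)]
  [fiberBundle : FiberBundle ℝ fibre]
  [vectorBundle : VectorBundle ℝ ℝ fibre]
  [smoothBundle : ContMDiffVectorBundle ∞ ℝ fibre (𝓡 M.dim)]

attribute [instance] LineBundle.addCommGroup LineBundle.module LineBundle.topFibre
  LineBundle.topTotal LineBundle.fiberBundle LineBundle.vectorBundle LineBundle.smoothBundle

variable {M : SmoothManifold.{u}}

/-- Smooth sections of `L`. -/
abbrev LineBundle.Sec (L : LineBundle.{u, v} M) : Type (max u v) :=
  Cₛ^∞⟮𝓡 M.dim; ℝ, L.fibre⟯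

/-- Smoothness of a set-theoretic section of `L`. -/
abbrev LineBundle.IsSmooth (L : LineBundle.{u, v} M) (s : ∀ x, L.fibre x) : Prop :=
  ContMDiff (𝓡 M.dim) ((𝓡 M.dim).prod 𝓘(ℝ, ℝ)) ∞ (fun x => Bundle.TotalSpace.mk' ℝ x (s x))

/-- The product `f e` of a function and a section. -/
def LineBundle.fsmul (L : LineBundle.{u, v} M) (f : M.Func) (e : L.Sec) : L.Sec :=
  ⟨fun x => f x • e x, f.contMDiff.smul_section e.contMDiff⟩

/-! ### Contact manifolds -/

/-- A hyperplane distribution: a smooth subbundle of `TM` (a field of subspaces locally spanned by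
smooth vector fields) of constant codimension one. -/
def IsHyperplaneDistribution (H : ∀ x : M, Submodule ℝ (M.Tangent x)) : Prop :=
  (∀ x, Module.finrank ℝ (M.Tangent x ⧸ H x) = 1) ∧
  ∀ x : M, ∃ U : Set M, IsOpen U ∧ x ∈ U ∧ ∃ (k : ℕ) (X : Fin k → ∀ y : M, M.Tangent y),
    (∀ i, ContMDiffOn (𝓡 M.dim) (𝓡 M.dim).tangent ∞
      (fun y => (⟨y, X i y⟩ : TangentBundle (𝓡 M.dim) M)) U) ∧
    ∀ y ∈ U, H y = Submodule.span ℝ (Set.range fun i => X i y)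

/-- Smooth sections of the distribution `H`. -/
def DistSec (H : ∀ x : M, Submodule ℝ (M.Tangent x)) : Type u :=
  {X : M.VField // ∀ x, X x ∈ H x}

/-- The curvature `κ_H(X, Y) = [X, Y] mod H` of a distribution on sections `X, Y` of `H`. -/
def curvature (H : ∀ x : M, Submodule ℝ (M.Tangent x)) (X Y : DistSec H) (x : M) :
    M.Tangent x ⧸ H x :=
  (H x).mkQ (VectorField.mlieBracket (𝓡 M.dim) X.1 Y.1 x)

/-- A contact structure: a hyperplane distribution whose curvature is non-degenerate. As `κ_H` is
tensorial, a vector `v ∈ H_x` lies in its kernel iff `κ_H(X, Y)` vanishes at `x` for all sections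
`X, Y` of `H` with `X_x = v`. -/
def IsContact (H : ∀ x : M, Submodule ℝ (M.Tangent x)) : Prop :=
  IsHyperplaneDistribution H ∧
  ∀ x : M, ∀ v ∈ H x, (∀ X Y : DistSec H, X.1 x = v → curvature H X Y x = 0) → v = 0

structure ContactManifold : Type (u + 1) where
  M : SmoothManifold.{u}
  H : ∀ x : M, Submodule ℝ (M.Tangent x)
  isContact : IsContact H

/-- A contactomorphism: a diffeomorphism identifying the contact structures. -/
@[ext]
structure Contactomorphism (C C' : ContactManifold.{u}) : Type u where
  base : Diffeo C.M C'.M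
  mem_iff : ∀ x v, base.d x v ∈ C'.H (base x) ↔ v ∈ C.H x

lemma Diffeo.d_refl (x : M) (w : M.Tangent x) :
    Diffeo.d (Diffeomorph.refl (𝓡 M.dim) M ∞ : Diffeo M M) x w = w := by
  have : mfderiv (𝓡 M.dim) (𝓡 M.dim) (Diffeomorph.refl (𝓡 M.dim) M ∞) x =
      ContinuousLinearMap.id ℝ (TangentSpace (𝓡 M.dim) x) := mfderiv_id
  exact congrArg (fun A => A w) this

lemma Diffeo.d_trans {M N P : SmoothManifold.{u}} (φ : Diffeo M N) (ψ : Diffeo N P) (x : M)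
    (w : M.Tangent x) :
    Diffeo.d (φ.trans ψ : Diffeo M P) x w = ψ.d (φ x) (φ.d x w) := by
  have : mfderiv (𝓡 M.dim) (𝓡 P.dim) (ψ ∘ φ) x = _ :=
    mfderiv_comp x (ψ.mdifferentiable (by simp) (φ x)) (φ.mdifferentiable (by simp) x)
  exact congrArg (fun A => A w) this

instance : Category ContactManifold.{u} where
  Hom := Contactomorphism
  id C := ⟨Diffeomorph.refl _ _ _, fun x w => by rw [Diffeo.d_refl]; rfl⟩
  comp f g := ⟨f.base.trans g.base, fun x w => by
    rw [Diffeo.d_trans]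
    exact (g.mem_iff _ _).trans (f.mem_iff x w)⟩

/-! ### The gauge algebroid -/

/-- The fibre `D_x L` of the gauge algebroid: derivations at `x`, i.e. linear maps
`δ : Γ(L) → L_x` together with a tangent vector `v ∈ T_x M`, the symbol (uniquely determined by
`δ`), such that `δ (f e) = v(f) e_x + f(x) δ(e)`. -/
def GaugeFibre (L : LineBundle.{u, v} M) (x : M) :
    Submodule ℝ ((L.Sec →ₗ[ℝ] L.fibre x) × M.Tangent x) where
  carrier := {p | ∀ (f : M.Func) (e : L.Sec),
    p.1 (L.fsmul f e) = mvfderiv (𝓡 M.dim) f x p.2 • e x + f x • p.1 e}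
  zero_mem' := fun f e => by simp
  add_mem' := fun {p q} hp hq f e => by
    simp only [Prod.fst_add, Prod.snd_add, LinearMap.add_apply, map_add, hp f e, hq f e]
    module
  smul_mem' := fun c p hp f e => by
    simp only [Prod.smul_fst, Prod.smul_snd, LinearMap.smul_apply, map_smul, hp f e, smul_eq_mul]
    module

/-- The symbol `σ : D_x L → T_x M`. -/
def symbol (L : LineBundle.{u, v} M) (x : M) : GaugeFibre L x →ₗ[ℝ] M.Tangent x :=
  (LinearMap.snd ℝ _ _).comp (GaugeFibre L x).subtype

/-- The value at `x` of the identity derivation. -/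
def identityAt (L : LineBundle.{u, v} M) (x : M) : GaugeFibre L x :=
  ⟨({ toFun := fun e => e x, map_add' := fun _ _ => rfl, map_smul' := fun _ _ => rfl }, 0),
    fun f e => by simp [LineBundle.fsmul]⟩

/-- Derivations of `L`, i.e. smooth sections of the gauge algebroid `DL`: linear operators
`D` on `Γ(L)` with `D (f e) = X(f) e + f D e` for a (necessarily unique) vector field `X`. -/
structure LDer (L : LineBundle.{u, v} M) : Type (max u v) where
  op : L.Sec →ₗ[ℝ] L.Sec
  sym : M.VField
  leibniz : ∀ (f : M.Func) (e : L.Sec) (x : M),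
    op (L.fsmul f e) x = mvfderiv (𝓡 M.dim) f x (sym x) • e x + f x • op e x

/-- The value of a derivation at a point. -/
def LDer.at {L : LineBundle.{u, v} M} (D : LDer L) (x : M) : GaugeFibre L x :=
  ⟨({ toFun := fun e => D.op e x
      map_add' := fun a b => by simp
      map_smul' := fun a b => by simp }, D.sym x), fun f e => D.leibniz f e x⟩

/-- The derivative `X(f)` of a function along a vector field. -/
def dirDeriv (X : M.VField) (f : M.Func) : M.Func :=
  ⟨fun x => mvfderiv (𝓡 M.dim) f x (X x),
    (contMDiff_snd_tangentBundle_modelSpace ℝ 𝓘(ℝ, ℝ)).comp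
      ((f.contMDiff.contMDiff_tangentMap (m := ∞) (by simp)).comp X.contMDiff)⟩

lemma isManifold_minSmoothness (M : SmoothManifold.{u}) (k : ℕ) :
    IsManifold (𝓡 M.dim) (minSmoothness ℝ k) M := by
  rw [minSmoothness_of_isRCLikeNormedField]
  exact IsManifold.of_le (n := ∞) (by exact_mod_cast le_top)

/-- The Lie bracket of vector fields. -/
def vbracket (X Y : M.VField) : M.VField :=
  ⟨fun x => VectorField.mlieBracket (𝓡 M.dim) X Y x,
    have : IsManifold (𝓡 M.dim) (minSmoothness ℝ 2) M := isManifold_minSmoothness M 2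
    have : IsManifold (𝓡 M.dim) (((⊤ : ℕ∞) : WithTop ℕ∞) + 1) M := M.isManifold
    ContDiff.mlieBracket_vectorField (m := ⊤) (n := ⊤) X.contMDiff Y.contMDiff (by simp)⟩

lemma dirDeriv_vbracket (X Y : M.VField) (f : M.Func) (x : M) :
    dirDeriv (vbracket X Y) f x = dirDeriv X (dirDeriv Y f) x - dirDeriv Y (dirDeriv X f) x := by
  by_cases hz : ∃ z : M.Tangent x, z ≠ 0
  swap
  · push Not at hz
    have h0 : ∀ (W : M.VField) (g : M.Func), dirDeriv W g x = 0 := fun W g => by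
      change mvfderiv (𝓡 M.dim) g x (W x) = 0
      rw [hz (W x), map_zero]
    simp [h0]
  obtain ⟨z, hz⟩ := hz
  have : IsManifold (𝓡 M.dim) (minSmoothness ℝ 3) M := isManifold_minSmoothness M 3
  have : IsManifold (𝓡 M.dim) (minSmoothness ℝ 2) M := isManifold_minSmoothness M 2
  have i2 : IsManifold (𝓡 M.dim) 2 M := by
    simpa using isManifold_minSmoothness M 2
  have i3 : IsManifold (𝓡 M.dim) (((2 : ℕ∞) : WithTop ℕ∞) + 1) M := by
    have := isManifold_minSmoothness M 3
    rw [minSmoothness_of_isRCLikeNormedField] at this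
    convert this using 1
    norm_num
  -- `C²` local fields, and the three facts needed about the Lie bracket
  let VDiffAt := fun (V : ∀ y : M, M.Tangent y) (y : M) =>
    MDifferentiableAt (𝓡 M.dim) (𝓡 M.dim).tangent
      (fun y => (⟨y, V y⟩ : TangentBundle (𝓡 M.dim) M)) y
  let br := fun V W : ∀ y : M, M.Tangent y => VectorField.mlieBracket (𝓡 M.dim) V W
  have hdiff : ∀ W : M.VField, ∀ y, VDiffAt (fun y => W y) y := fun W y =>
    (W.contMDiff y).mdifferentiableAt (by simp)
  have hdf : ∀ g : M.Func, ∀ y, MDifferentiableAt (𝓡 M.dim) 𝓘(ℝ, ℝ) g y := fun g y =>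
    (g.contMDiff y).mdifferentiableAt (by simp)
  obtain ⟨s, hs, hZs⟩ := FiberBundle.exists_contMDiffOn_extend (k := ∞) (𝓡 M.dim)
    (EuclideanSpace ℝ (Fin M.dim)) z
  let Z : ∀ y : M, M.Tangent y := FiberBundle.extend (EuclideanSpace ℝ (Fin M.dim)) z
  have hZx : Z x = z := by simp [Z]
  have hZ : ∀ᶠ y in nhds x, ContMDiffAt (𝓡 M.dim) (𝓡 M.dim).tangent ∞
      (fun y => (⟨y, Z y⟩ : TangentBundle (𝓡 M.dim) M)) y := by
    filter_upwards [eventually_eventually_nhds.2 hs] with y hy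
    exact hZs.contMDiffAt hy
  have hbrZ : ∀ W : M.VField, ∀ᶠ y in nhds x, VDiffAt (br W Z) y := fun W => by
    filter_upwards [hZ] with y hy
    have h2 : ContMDiffAt (𝓡 M.dim) (𝓡 M.dim).tangent ((1 : ℕ∞) : WithTop ℕ∞)
        (fun y => (⟨y, br W Z y⟩ : TangentBundle (𝓡 M.dim) M)) y :=
      ContMDiffAt.mlieBracket_vectorField (m := 1) (n := 2)
        ((W.contMDiff y).of_le (by exact_mod_cast le_top)) (hy.of_le (by exact_mod_cast le_top))
        (by simp; norm_num)
    exact h2.mdifferentiableAt (by simp)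
  have hsm : ∀ (W : M.VField) (g : M.Func), ∀ᶠ y in nhds x,
      br W (⇑g • Z) y = (⇑(dirDeriv W g) • Z + ⇑g • br W Z) y := fun W g => by
    filter_upwards [hZ] with y hy
    exact VectorField.mlieBracket_smul_right (hdf g y) (hy.mdifferentiableAt (by simp))
  have hsecond : ∀ (V W : M.VField), br V (br W (⇑f • Z)) x =
      dirDeriv V (dirDeriv W f) x • Z x + dirDeriv W f x • br V Z x
        + (dirDeriv V f x • br W Z x + f x • br V (br W Z) x) := fun V W => by
    have h1 : br V (br W (⇑f • Z)) x = br V (⇑(dirDeriv W f) • Z + ⇑f • br W Z) x :=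
      Filter.EventuallyEq.mlieBracket_vectorField_eq Filter.EventuallyEq.rfl (hsm W f)
    have hZx' := hZ.self_of_nhds.mdifferentiableAt (by simp)
    have h2 : br V (⇑(dirDeriv W f) • Z + ⇑f • br W Z) x = _ :=
      VectorField.mlieBracket_add_right ((hdf (dirDeriv W f) x).smul_section hZx')
        ((hdf f x).smul_section (hbrZ W).self_of_nhds)
    have h3 : br V (⇑(dirDeriv W f) • Z) x = _ := (hsm V (dirDeriv W f)).self_of_nhds
    have h4 : br V (⇑f • br W Z) x = _ :=
      VectorField.mlieBracket_smul_right (hdf f x) (hbrZ W).self_of_nhds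
    rw [h1, h2]
    exact congrArg₂ (· + ·) h3 h4
  have c2 : ∀ W : M.VField, ContMDiffAt (𝓡 M.dim) (𝓡 M.dim).tangent (minSmoothness ℝ 2)
      (fun y => (⟨y, W y⟩ : TangentBundle (𝓡 M.dim) M)) x := fun W =>
    (W.contMDiff x).of_le (by simpa using ENat.LEInfty.out)
  have cZ : ContMDiffAt (𝓡 M.dim) (𝓡 M.dim).tangent (minSmoothness ℝ 2)
      (fun y => (⟨y, Z y⟩ : TangentBundle (𝓡 M.dim) M)) x :=
    hZ.self_of_nhds.of_le (by simpa using ENat.LEInfty.out)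
  have cfZ : ContMDiffAt (𝓡 M.dim) (𝓡 M.dim).tangent (minSmoothness ℝ 2)
      (fun y => (⟨y, (⇑f • Z) y⟩ : TangentBundle (𝓡 M.dim) M)) x :=
    ((f.contMDiff x).of_le (by simpa using ENat.LEInfty.out)).smul_section cZ
  have J1 : br X (br Y (⇑f • Z)) x = br (vbracket X Y) (⇑f • Z) x + br Y (br X (⇑f • Z)) x :=
    VectorField.leibniz_identity_mlieBracket_apply (c2 X) (c2 Y) cfZ
  have J2 : br X (br Y Z) x = br (vbracket X Y) Z x + br Y (br X Z) x :=
    VectorField.leibniz_identity_mlieBracket_apply (c2 X) (c2 Y) cZ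
  have h5 : br (vbracket X Y) (⇑f • Z) x =
      dirDeriv (vbracket X Y) f x • Z x + f x • br (vbracket X Y) Z x :=
    (hsm (vbracket X Y) f).self_of_nhds
  rw [hsecond X Y, hsecond Y X, h5, J2, hZx] at J1
  have h6 : (dirDeriv (vbracket X Y) f x -
      (dirDeriv X (dirDeriv Y f) x - dirDeriv Y (dirDeriv X f) x)) • z = 0 := by
    rw [sub_smul, sub_smul]
    have := sub_eq_zero.2 J1
    rw [← neg_eq_zero, ← this]
    module
  exact sub_eq_zero.1 ((smul_eq_zero.1 h6).resolve_right hz)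

/-- The bracket of the gauge algebroid: the commutator of derivations. -/
def LDer.bracket {L : LineBundle.{u, v} M} (D D' : LDer L) : LDer L where
  op := D.op.comp D'.op - D'.op.comp D.op
  sym := vbracket D.sym D'.sym
  leibniz f e x := by
    have key : ∀ D : LDer L, ∀ (f : M.Func) (e : L.Sec),
        D.op (L.fsmul f e) = L.fsmul (dirDeriv D.sym f) e + L.fsmul f (D.op e) := by
      intro D f e
      ext x
      exact D.leibniz f e x
    have hb := dirDeriv_vbracket D.sym D'.sym f x
    change mvfderiv (𝓡 M.dim) f x (vbracket D.sym D'.sym x) = _ at hb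
    rw [hb]
    simp only [LinearMap.sub_apply, LinearMap.comp_apply, key, map_add, ContMDiffSection.coe_sub,
      ContMDiffSection.coe_add, Pi.sub_apply, Pi.add_apply]
    simp only [LineBundle.fsmul, ContMDiffSection.coeFn_mk]
    module

/-! ### Atiyah forms -/

/-- Atiyah 1-forms `DL → L`: fields of linear maps `D_x L → L_x`, smooth in the sense that they
map smooth sections to smooth sections. -/
structure AtiyahOneForm (L : LineBundle.{u, v} M) : Type (max u v) where
  toFun : ∀ x, GaugeFibre L x →ₗ[ℝ] L.fibre x
  smooth : ∀ D : LDer L, L.IsSmooth fun x => toFun x (D.at x)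

/-- Atiyah 2-forms `∧² DL → L`. -/
structure AtiyahTwoForm (L : LineBundle.{u, v} M) : Type (max u v) where
  toFun : ∀ x, GaugeFibre L x →ₗ[ℝ] GaugeFibre L x →ₗ[ℝ] L.fibre x
  alternating : ∀ x δ, toFun x δ δ = 0
  smooth : ∀ D D' : LDer L, L.IsSmooth fun x => toFun x (D.at x) (D'.at x)

variable {L : LineBundle.{u, v} M}

/-- The section `Θ(D)`. -/
def AtiyahOneForm.eval (Θ : AtiyahOneForm L) (D : LDer L) : L.Sec :=
  ⟨fun x => Θ.toFun x (D.at x), Θ.smooth D⟩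

/-- The section `ω(D, D')`. -/
def AtiyahTwoForm.eval (w : AtiyahTwoForm L) (D D' : LDer L) : L.Sec :=
  ⟨fun x => w.toFun x (D.at x) (D'.at x), w.smooth D D'⟩

/-- The differential `d_D Θ` of an Atiyah 1-form, evaluated on two derivations. -/
def AtiyahOneForm.dD (Θ : AtiyahOneForm L) (D₁ D₂ : LDer L) : L.Sec :=
  D₁.op (Θ.eval D₂) - D₂.op (Θ.eval D₁) - Θ.eval (D₁.bracket D₂)

/-- The differential `d_D ω` of an Atiyah 2-form, evaluated on three derivations. -/
def AtiyahTwoForm.dD (w : AtiyahTwoForm L) (D₁ D₂ D₃ : LDer L) : L.Sec :=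
  D₁.op (w.eval D₂ D₃) - D₂.op (w.eval D₁ D₃) + D₃.op (w.eval D₁ D₂)
    - w.eval (D₁.bracket D₂) D₃ + w.eval (D₁.bracket D₃) D₂ - w.eval (D₂.bracket D₃) D₁

/-- The interior product `ι_𝕀 ω` with the identity derivation. -/
def AtiyahTwoForm.interiorId (w : AtiyahTwoForm L) : AtiyahOneForm L where
  toFun x := w.toFun x (identityAt L x)
  smooth D := w.smooth ⟨LinearMap.id, 0, fun f e x => by simp [LineBundle.fsmul]⟩ D

/-- `ω` is symplectic: `d_D`-closed and non-degenerate, i.e. `ω_♭ : DL → Hom(DL, L)`,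
`δ ↦ ω(δ, -)`, is an isomorphism. -/
def AtiyahTwoForm.IsSymplectic (w : AtiyahTwoForm L) : Prop :=
  (∀ D₁ D₂ D₃, w.dD D₁ D₂ D₃ = 0) ∧ ∀ x, Function.Bijective (w.toFun x)

/-- `L`-valued 1-forms on `M`. -/
@[ext]
structure OneForm (L : LineBundle.{u, v} M) : Type (max u v) where
  toFun : ∀ x, M.Tangent x →ₗ[ℝ] L.fibre x
  smooth : ∀ X : M.VField, L.IsSmooth fun x => toFun x (X x)

/-- The Atiyah 1-form `θ ∘ σ`. -/
def OneForm.compSymbol (θ : OneForm L) : AtiyahOneForm L where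
  toFun x := (θ.toFun x).comp (symbol L x)
  smooth D := θ.smooth D.sym

/-! ### Symplectic Atiyah bundles -/

/-- A vector bundle isomorphism `L → L'`, covering a diffeomorphism of the bases. -/
@[ext]
structure LineBundleIso {M M' : SmoothManifold.{u}} (L : LineBundle.{u, v} M)
    (L' : LineBundle.{u, v} M') : Type (max u v) where
  base : Diffeo M M'
  fibre : ∀ x, L.fibre x ≃ₗ[ℝ] L'.fibre (base x)
  total : Bundle.TotalSpace ℝ L.fibre
    ≃ₘ^∞⟮(𝓡 M.dim).prod 𝓘(ℝ, ℝ), (𝓡 M'.dim).prod 𝓘(ℝ, ℝ)⟯ Bundle.TotalSpace ℝ L'.fibre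
  total_mk : ∀ x l, total ⟨x, l⟩ = ⟨base x, fibre x l⟩

namespace LineBundleIso

variable {M M' M'' : SmoothManifold.{u}} {L : LineBundle.{u, v} M} {L' : LineBundle.{u, v} M'}
  {L'' : LineBundle.{u, v} M''}

def refl (L : LineBundle.{u, v} M) : LineBundleIso L L where
  base := Diffeomorph.refl _ _ _
  fibre _ := LinearEquiv.refl ℝ _
  total := Diffeomorph.refl _ _ _
  total_mk _ _ := rfl

def trans (F : LineBundleIso L L') (G : LineBundleIso L' L'') : LineBundleIso L L'' where
  base := F.base.trans G.base
  fibre x := (F.fibre x).trans (G.fibre (F.base x))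
  total := F.total.trans G.total
  total_mk x l := by
    change G.total (F.total ⟨x, l⟩) = _
    rw [F.total_mk, G.total_mk]
    rfl

/-- The pull-back `Γ(L') → Γ(L)` of sections, `(F^* e)_x = F_x⁻¹ (e_{φ x})`. -/
def pullback (F : LineBundleIso L L') : L'.Sec →ₗ[ℝ] L.Sec where
  toFun e := ⟨fun x => (F.fibre x).symm (e (F.base x)), by
    have h : (fun x => Bundle.TotalSpace.mk' ℝ x ((F.fibre x).symm (e (F.base x)))) =
        fun x => F.total.symm (Bundle.TotalSpace.mk' ℝ (F.base x) (e (F.base x))) := by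
      funext x
      rw [← F.total.symm_apply_apply (Bundle.TotalSpace.mk' ℝ x _)]
      congr 1
      exact (F.total_mk _ _).trans (by simp)
    rw [h]
    exact F.total.symm.contMDiff.comp (e.contMDiff.comp F.base.contMDiff)⟩
  map_add' a b := by ext x; exact map_add (F.fibre x).symm _ _
  map_smul' a b := by ext x; exact map_smul (F.fibre x).symm _ _

/-- The induced map `D_x L → D_{φ x} L'` of gauge algebroids, `δ ↦ F_x ∘ δ ∘ F^*`, covering
`dφ` on symbols. -/
def push (F : LineBundleIso L L') (x : M) : GaugeFibre L x →ₗ[ℝ] GaugeFibre L' (F.base x) where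
  toFun δ := ⟨((F.fibre x).toLinearMap.comp (δ.1.1.comp F.pullback), F.base.d x δ.1.2), by
    intro f e
    have h : F.pullback (L'.fsmul f e) =
        L.fsmul (f.comp ⟨F.base, F.base.contMDiff⟩) (F.pullback e) := by
      ext y
      exact map_smul (F.fibre y).symm _ _
    have hd : mvfderiv (𝓡 M.dim) (f ∘ F.base) x δ.1.2 =
        mvfderiv (𝓡 M'.dim) f (F.base x) (F.base.d x δ.1.2) :=
      mvfderiv_comp_apply x (f.contMDiff.mdifferentiable (by simp) _)
        (F.base.mdifferentiable (by simp) x) δ.1.2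
    have hl := δ.2 (f.comp ⟨F.base, F.base.contMDiff⟩) (F.pullback e)
    simp only [LinearMap.comp_apply, h]
    rw [hl, map_add, map_smul, map_smul, ← hd]
    congr 2
    exact (F.fibre x).apply_symm_apply _⟩
  map_add' a b := by
    apply Subtype.ext
    apply Prod.ext
    · ext e; exact map_add (F.fibre x) _ _
    · exact map_add (F.base.d x) _ _
  map_smul' a b := by
    apply Subtype.ext
    apply Prod.ext
    · ext e; exact map_smul (F.fibre x) _ _
    · exact map_smul (F.base.d x) _ _

lemma push_refl (x : M) (δ : GaugeFibre L x) : (refl L).push x δ = δ := by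
  apply Subtype.ext
  apply Prod.ext
  · rfl
  · exact Diffeo.d_refl x _

lemma push_trans (F : LineBundleIso L L') (G : LineBundleIso L' L'') (x : M)
    (δ : GaugeFibre L x) : (F.trans G).push x δ = G.push (F.base x) (F.push x δ) := by
  apply Subtype.ext
  apply Prod.ext
  · rfl
  · exact Diffeo.d_trans F.base G.base x _

end LineBundleIso

/-- A symplectic Atiyah bundle: a line bundle with a symplectic Atiyah form. -/
structure SymplecticAtiyahBundle : Type (max (u + 1) (v + 1)) where
  M : SmoothManifold.{u}
  L : LineBundle.{u, v} M
  form : AtiyahTwoForm L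
  isSymplectic : form.IsSymplectic

/-- A symplectic Atiyah morphism: a vector bundle isomorphism identifying the symplectic Atiyah
forms. -/
@[ext]
structure SymplecticAtiyahMorphism (S S' : SymplecticAtiyahBundle.{u, v}) : Type (max u v) extends
    LineBundleIso S.L S'.L where
  map_form : ∀ x (δ ε : GaugeFibre S.L x),
    S'.form.toFun (base x) (toLineBundleIso.push x δ) (toLineBundleIso.push x ε) =
      fibre x (S.form.toFun x δ ε)

instance : Category SymplecticAtiyahBundle.{u, v} where
  Hom := SymplecticAtiyahMorphism
  id S := ⟨LineBundleIso.refl S.L, fun x δ ε => by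
    rw [LineBundleIso.push_refl, LineBundleIso.push_refl]; rfl⟩
  comp F G := ⟨F.toLineBundleIso.trans G.toLineBundleIso, fun x δ ε => by
    rw [LineBundleIso.push_trans, LineBundleIso.push_trans]
    exact (G.map_form _ _ _).trans (congrArg (G.fibre (F.base x)) (F.map_form x δ ε))⟩

end AtiyahContact

end

open scoped Manifold ContDiff Bundle
open CategoryTheory

noncomputable section

namespace AtiyahContact

universe u v

/-! ### Global sections with prescribed values -/

section Frames

variable {M : SmoothManifold.{u}}

/-! The key fact is that `L`-valued 1-forms `θ` on `M` and closed Atiyah 2-forms `ω` on `L` are the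
same thing. The operator `𝕀` acts as the identity and commutes with every derivation, so inserting
it into `d_D ω = 0` leaves `ω = d_D (ι_𝕀 ω)` (`AtiyahTwoForm.eval_eq_dD_oneForm`). As `ω(𝕀, 𝕀) = 0`
and `ker σ` is the line spanned by `𝕀`, the form `ι_𝕀 ω` descends along `σ` to a 1-form `θ`
(`exists_oneForm`). Conversely `d_D (θ ∘ σ)` is tensorial and closed, and contracting it with `𝕀`
returns `θ ∘ σ` (`OneForm.twoFormAt_identity`).

For surjective `θ`, non-degeneracy of `ω` is the contact condition on `ker θ`
(`OneForm.isContact_iff`): `ω` pairs `𝕀` with `TM / ker θ`, and over `ker θ` it is minus the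
curvature (`OneForm.twoFormAt_of_ker`). Non-degeneracy of `ω` in turn forces `θ` to be surjective.

Hence `(L, ω) ↦ (M, ker θ)` is a functor, and it is shown to be an equivalence without choosing an
inverse by hand. A morphism is determined on fibres by its base map, because `θ` is onto. A
contactomorphism lifts to the line bundles compatibly with the 1-forms (`exists_lineBundleIso`),
hence with their differentials (`LineBundleIso.twoFormAt_push`). Every contact structure is the
kernel of the projection to a normal line bundle, glued from local defining forms
(`IsHyperplaneDistribution.exists_oneForm`). -/

lemma SmoothManifold.exists_cutoff (x : M) {U : Set M} (hU : U ∈ nhds x) :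
    ∃ ρ : M.Func, (∀ᶠ y in nhds x, ρ y = 1) ∧ tsupport ρ ⊆ U := by
  obtain ⟨ρ, -, h⟩ := (SmoothBumpFunction.nhds_basis_tsupport (I := 𝓡 M.dim) x).mem_iff.1 hU
  exact ⟨⟨ρ, ρ.contMDiff⟩, ρ.eventuallyEq_one, h⟩

/-- Sections `E i` and dual sections `c i` of a vector bundle such that `∑ c i ⊗ E i` is the
identity up to a factor `η` which is `1` near a given point. -/
lemma exists_frame {F : Type*} [NormedAddCommGroup F] [NormedSpace ℝ F] [FiniteDimensional ℝ F]
    {V : M → Type*} [∀ x, AddCommGroup (V x)] [∀ x, Module ℝ (V x)] [∀ x, TopologicalSpace (V x)]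
    [TopologicalSpace (Bundle.TotalSpace F V)] [FiberBundle F V] [VectorBundle ℝ F V]
    [ContMDiffVectorBundle ∞ F V (𝓡 M.dim)] {ι : Type*} [Fintype ι] (b : Module.Basis ι ℝ F)
    (x : M) :
    ∃ (E : ι → Cₛ^∞⟮𝓡 M.dim; F, V⟯) (c : ι → ∀ y, V y →ₗ[ℝ] ℝ) (η : M.Func),
      (∀ᶠ y in nhds x, η y = 1) ∧
      (∀ i (s : Cₛ^∞⟮𝓡 M.dim; F, V⟯),
        ContMDiff (𝓡 M.dim) 𝓘(ℝ, ℝ) ∞ fun y => c i y (s y)) ∧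
      ∀ y (w : V y), ∑ i, c i y w • E i y = η y • w := by
  have : ContMDiffVectorBundle 1 F V (𝓡 M.dim) :=
    ContMDiffVectorBundle.of_le (n := ∞) (by exact_mod_cast le_top)
  let e := trivializationAt F V x
  have hx : x ∈ e.baseSet := FiberBundle.mem_baseSet_trivializationAt' x
  obtain ⟨ρ, hρ, hs⟩ := SmoothManifold.exists_cutoff x (e.open_baseSet.mem_nhds hx)
  -- The cutoff multiplies both the local frame and its coefficients, so that each extends smoothly
  -- by zero; hence the factor `η = ρ * ρ`.
  refine ⟨fun i => ⟨fun y => ρ y • e.localFrame b i y, ?_⟩,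
    fun i y => ρ y • e.localFrameCoeff (𝓡 M.dim) b i y, ρ * ρ, ?_, ?_, ?_⟩
  · exact ContMDiffOn.smul_section_of_tsupport (ψ := ρ) ρ.contMDiff.contMDiffOn e.open_baseSet hs
      (e.contMDiffOn_localFrame_baseSet ∞ b i)
  · filter_upwards [hρ] with y hy
    simp [hy]
  · intro i s
    refine contMDiff_of_tsupport fun y hy => ?_
    have hy' : y ∈ e.baseSet := hs <| closure_mono (fun z hz => by
      simp only [Function.mem_support, LinearMap.smul_apply] at hz ⊢
      exact left_ne_zero_of_smul hz) hy
    exact (ρ.contMDiff y).smul (contMDiffAt_localFrameCoeff b hy' (s.contMDiff y) i)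
  · classical
    intro y w
    by_cases hy : y ∈ e.baseSet
    -- The coefficients are evaluated on sections, so `w` is extended by zero off `y`; no smoothness
    -- is needed.
    · have h := e.eq_sum_localFrameCoeff_smul (I := 𝓡 M.dim) (b := b)
        (s := fun z => if h : z = y then h ▸ w else 0) hy
      simp only [dite_true] at h
      conv_rhs => rw [h]
      rw [Finset.smul_sum]
      refine Finset.sum_congr rfl fun i _ => ?_
      simp only [LinearMap.smul_apply, ContMDiffSection.coeFn_mk, smul_eq_mul,
        ContMDiffMap.coe_mul, Pi.mul_apply]
      module
    · have h0 : ρ y = 0 := image_eq_zero_of_notMem_tsupport fun h => hy (hs h)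
      simp [h0]

/-- The vector field `f X`. -/
def SmoothManifold.vsmul (f : M.Func) (X : M.VField) : M.VField :=
  ⟨fun x => f x • X x, f.contMDiff.smul_section X.contMDiff⟩

lemma SmoothManifold.exists_vfield_frame (x : M) :
    ∃ (E : Fin M.dim → M.VField) (c : Fin M.dim → ∀ y, M.Tangent y →ₗ[ℝ] ℝ) (η : M.Func),
      (∀ᶠ y in nhds x, η y = 1) ∧
      (∀ i (X : M.VField), ContMDiff (𝓡 M.dim) 𝓘(ℝ, ℝ) ∞ fun y => c i y (X y)) ∧
      ∀ y (w : M.Tangent y), ∑ i, c i y w • E i y = η y • w :=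
  exists_frame (EuclideanSpace.basisFun (Fin M.dim) ℝ).toBasis x

lemma SmoothManifold.exists_vfield (x : M) (w : M.Tangent x) : ∃ X : M.VField, X x = w := by
  obtain ⟨E, c, η, hη, -, h⟩ := SmoothManifold.exists_vfield_frame x
  refine ⟨∑ i, c i x w • E i, ?_⟩
  have := h x w
  rw [hη.self_of_nhds, one_smul] at this
  have h2 : ⇑(∑ i, c i x w • E i) = ∑ i, ⇑(c i x w • E i) :=
    map_sum (ContMDiffSection.coeAddHom _ _ _ _) _ _
  rw [h2, Finset.sum_apply]
  exact this

end Frames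

/-! ### Line bundles -/

namespace LineBundle

variable {M : SmoothManifold.{u}} (L : LineBundle.{u, v} M)

lemma finrank_fibre (x : M) : Module.finrank ℝ (L.fibre x) = 1 := by
  have e := (trivializationAt ℝ L.fibre x).linearEquivAt (R := ℝ) x
    (FiberBundle.mem_baseSet_trivializationAt' x)
  rw [e.finrank_eq, Module.finrank_self]

/-- A smooth section of the dual bundle. -/
structure Dual where
  toFun : ∀ x, L.fibre x →ₗ[ℝ] ℝ
  smooth : ∀ e : L.Sec, ContMDiff (𝓡 M.dim) 𝓘(ℝ, ℝ) ∞ fun x => toFun x (e x)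

variable {L}

/-- The pairing of a section with a dual section. -/
def Dual.eval (φ : L.Dual) (e : L.Sec) : M.Func := ⟨fun x => φ.toFun x (e x), φ.smooth e⟩

@[simp] lemma Dual.eval_apply (φ : L.Dual) (e : L.Sec) (x : M) : φ.eval e x = φ.toFun x (e x) := rfl

@[simp] lemma fsmul_apply (f : M.Func) (e : L.Sec) (x : M) : L.fsmul f e x = f x • e x := rfl

/-- In a line, `φ(l) l' = φ(l') l`. -/
lemma dual_smul_comm {x : M} (φ : L.fibre x →ₗ[ℝ] ℝ) (l l' : L.fibre x) : φ l • l' = φ l' • l := by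
  obtain ⟨z, -, hz⟩ := finrank_eq_one_iff'.1 (L.finrank_fibre x)
  obtain ⟨a, rfl⟩ := hz l
  obtain ⟨b, rfl⟩ := hz l'
  simp only [map_smul, smul_eq_mul]
  module

variable (L) in
lemma exists_dual (x : M) : ∃ (φ : L.Dual) (e : L.Sec), φ.toFun x (e x) = 1 := by
  obtain ⟨E, c, η, hη, hc, h⟩ := exists_frame (V := L.fibre) (Module.Basis.singleton Unit ℝ) x
  simp only [Finset.univ_unique, Finset.sum_singleton] at h
  refine ⟨⟨c default, hc default⟩, E default, ?_⟩
  have hex : ∃ l : L.fibre x, l ≠ 0 := by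
    have := Module.nontrivial_of_finrank_eq_succ (L.finrank_fibre x)
    exact exists_ne 0
  obtain ⟨l, hl⟩ := hex
  have h1 := h x l
  -- The frame identity `c(l) E = l`, rewritten as `c(E) l = l`, forces `c(E) = 1` at `x`.
  rw [hη.self_of_nhds, one_smul, dual_smul_comm] at h1
  have h2 : (c default x (E default x) - 1) • l = 0 := by rw [sub_smul, one_smul, h1, sub_self]
  exact sub_eq_zero.1 ((smul_eq_zero.1 h2).resolve_right hl)

end LineBundle

/-! ### Derivations -/

section Derivations

variable {M : SmoothManifold.{u}} {L : LineBundle.{u, v} M}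

@[simp] lemma LDer.symbol_at (D : LDer L) (x : M) : symbol L x (D.at x) = D.sym x := rfl

variable (L) in
/-- The identity derivation. -/
def LDer.identity : LDer L where
  op := LinearMap.id
  sym := 0
  leibniz f e x := by simp [LineBundle.fsmul]

lemma LDer.identity_at (x : M) : (LDer.identity L).at x = identityAt L x := rfl

lemma symbol_identityAt (x : M) : symbol L x (identityAt L x) = 0 := rfl

/-- With zero symbol, `δ` is linear over functions. Applying it to `φ(e) e₀ = φ(e₀) e`, an identity
valid because the fibres are lines, gives `δ e = φ(δ e₀) e` at `x`. -/
lemma exists_smul_identityAt {x : M} {δ : GaugeFibre L x} (h : symbol L x δ = 0) :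
    ∃ c : ℝ, δ = c • identityAt L x := by
  obtain ⟨φ, e₀, h₀⟩ := L.exists_dual x
  have hv : δ.1.2 = 0 := h
  refine ⟨φ.toFun x (δ.1.1 e₀), Subtype.ext (Prod.ext (LinearMap.ext fun e => ?_) ?_)⟩
  · have h1 := δ.2 (φ.eval e) e₀
    have h2 := δ.2 (φ.eval e₀) e
    have h3 : L.fsmul (φ.eval e) e₀ = L.fsmul (φ.eval e₀) e := by
      ext y
      exact LineBundle.dual_smul_comm _ _ _
    rw [h3, h2, hv, map_zero, map_zero, zero_smul, zero_smul, zero_add, zero_add,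
      φ.eval_apply, φ.eval_apply, h₀, one_smul] at h1
    rw [h1, LineBundle.dual_smul_comm]
    rfl
  · rw [hv]
    exact (smul_zero _).symm

end Derivations

section Derivations

variable {M : SmoothManifold.{u}} {L : LineBundle.{u, v} M}

lemma dirDeriv_add (X : M.VField) (f g : M.Func) :
    dirDeriv X (f + g) = dirDeriv X f + dirDeriv X g := by
  ext x
  have hf := f.contMDiff.mdifferentiable (by simp) x
  have hg := g.contMDiff.mdifferentiable (by simp) x
  exact congrArg (fun A => A (X x)) (mvfderiv_add hf hg)

lemma dirDeriv_mul (X : M.VField) (f g : M.Func) :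
    dirDeriv X (f * g) = f * dirDeriv X g + dirDeriv X f * g := by
  ext x
  have hf := f.contMDiff.mdifferentiable (by simp) x
  have hg := g.contMDiff.mdifferentiable (by simp) x
  have := congrArg (fun A => A (X x)) (mvfderiv_mul hf hg)
  refine this.trans ?_
  change f x * _ + g x * _ = f x * _ + _ * g x
  rw [mul_comm (g x)]
  rfl

lemma dirDeriv_smul (X : M.VField) (c : ℝ) (f : M.Func) :
    dirDeriv X (c • f) = c • dirDeriv X f := by
  let k : M.Func := ⟨fun _ => c, contMDiff_const⟩
  have hk : dirDeriv X k = 0 := by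
    ext x
    exact congrArg (fun A => A (X x)) (mvfderiv_const c)
  have h : ∀ g : M.Func, c • g = k * g := fun g => rfl
  rw [h, h, dirDeriv_mul, hk, zero_mul, add_zero]

/-- The derivation `e ↦ X(φ(e)) e₀ + c e`, with symbol `φ(e₀) X`. -/
def LDer.ofDual (φ : L.Dual) (e₀ : L.Sec) (X : M.VField) (c : ℝ) : LDer L where
  op := { toFun := fun e => L.fsmul (dirDeriv X (φ.eval e)) e₀ + c • e
          map_add' := fun e e' => by
            have : φ.eval (e + e') = φ.eval e + φ.eval e' := by ext x; simp
            rw [this, dirDeriv_add]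
            ext x
            simp only [ContMDiffSection.coe_add, Pi.add_apply, LineBundle.fsmul_apply,
              ContMDiffMap.coe_add, smul_add, ContMDiffSection.coe_smul, Pi.smul_apply]
            module
          map_smul' := fun a e => by
            have : φ.eval (a • e) = a • φ.eval e := by ext x; simp
            rw [this, dirDeriv_smul]
            ext x
            simp only [ContMDiffSection.coe_add, Pi.add_apply, LineBundle.fsmul_apply,
              ContMDiffMap.coe_smul, ContMDiffSection.coe_smul, Pi.smul_apply, RingHom.id_apply,
              smul_eq_mul]
            module }
  sym := M.vsmul (φ.eval e₀) X
  leibniz f e x := by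
    have h : φ.eval (L.fsmul f e) = f * φ.eval e := by ext x; simp
    -- Rank one enters here: the Leibniz term `X(f) φ(e) e₀` equals `φ(e₀) X(f) e`, which identifies
    -- the symbol as `φ(e₀) X`.
    have h2 := LineBundle.dual_smul_comm (φ.toFun x) (e x) (e₀ x)
    change (dirDeriv X (φ.eval (L.fsmul f e)) x) • e₀ x + c • f x • e x =
      (mvfderiv (𝓡 M.dim) f x (φ.toFun x (e₀ x) • X x)) • e x +
        f x • (dirDeriv X (φ.eval e) x • e₀ x + c • e x)
    rw [h, dirDeriv_mul, map_smul]
    change (f x * dirDeriv X (φ.eval e) x + dirDeriv X f x * φ.toFun x (e x)) • e₀ x +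
      c • f x • e x = (φ.toFun x (e₀ x) * dirDeriv X f x) • e x +
        f x • (dirDeriv X (φ.eval e) x • e₀ x + c • e x)
    rw [add_smul, mul_smul (dirDeriv X f x), h2]
    module

/-- Every element of the gauge algebroid extends to a derivation, whose symbol may be prescribed up
to a function. -/
lemma exists_LDer {x : M} (δ : GaugeFibre L x) (X : M.VField) (hX : X x = symbol L x δ) :
    ∃ (D : LDer L) (η : M.Func), D.at x = δ ∧ η x = 1 ∧ D.sym = M.vsmul η X := by
  obtain ⟨φ, e₀, h₀⟩ := L.exists_dual x
  have h1 : (M.vsmul (φ.eval e₀) X) x = X x := by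
    change φ.toFun x (e₀ x) • X x = _
    rw [h₀, one_smul]
  -- The derivation with `c = 0` already has the right symbol at `x`, so it misses `δ` only by a
  -- multiple of `𝕀`, which becomes the constant `c`.
  obtain ⟨c, hc⟩ := exists_smul_identityAt (δ := δ - (LDer.ofDual φ e₀ X 0).at x) (by
    rw [map_sub, LDer.symbol_at, ← hX]
    exact sub_eq_zero.2 h1.symm)
  refine ⟨LDer.ofDual φ e₀ X c, φ.eval e₀, ?_, h₀, rfl⟩
  rw [sub_eq_iff_eq_add] at hc
  rw [hc]
  refine Subtype.ext (Prod.ext (LinearMap.ext fun e => ?_) ?_)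
  · change dirDeriv X (φ.eval e) x • e₀ x + c • e x =
      c • e x + (dirDeriv X (φ.eval e) x • e₀ x + (0 : ℝ) • e x)
    module
  · change (M.vsmul (φ.eval e₀) X) x = c • (0 : M.Tangent x) + (M.vsmul (φ.eval e₀) X) x
    rw [smul_zero, zero_add]

lemma exists_LDer_at {x : M} (δ : GaugeFibre L x) : ∃ D : LDer L, D.at x = δ := by
  obtain ⟨X, hX⟩ := SmoothManifold.exists_vfield x (symbol L x δ)
  obtain ⟨D, -, hD, -⟩ := exists_LDer δ X hX
  exact ⟨D, hD⟩

variable (L) in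
lemma symbol_surjective (x : M) : Function.Surjective (symbol L x) := fun w => by
  obtain ⟨X, hX⟩ := SmoothManifold.exists_vfield x w
  obtain ⟨φ, e₀, h₀⟩ := L.exists_dual x
  refine ⟨(LDer.ofDual φ e₀ X 0).at x, ?_⟩
  change φ.toFun x (e₀ x) • X x = w
  rw [h₀, one_smul, hX]

lemma identityAt_ne_zero (x : M) : identityAt L x ≠ 0 := fun h => by
  obtain ⟨φ, e₀, h₀⟩ := L.exists_dual x
  have h1 : e₀ x = 0 := congrArg (fun δ : GaugeFibre L x => δ.1.1 e₀) h
  rw [h1, map_zero] at h₀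
  exact zero_ne_one h₀

lemma ker_symbol (x : M) : LinearMap.ker (symbol L x) = ℝ ∙ identityAt L x := by
  ext δ
  rw [LinearMap.mem_ker, Submodule.mem_span_singleton]
  constructor
  · intro h
    obtain ⟨c, hc⟩ := exists_smul_identityAt h
    exact ⟨c, hc.symm⟩
  · rintro ⟨c, rfl⟩
    rw [map_smul, symbol_identityAt, smul_zero]

instance finiteDimensional_tangent (x : M) : FiniteDimensional ℝ (M.Tangent x) :=
  inferInstanceAs (FiniteDimensional ℝ (EuclideanSpace ℝ (Fin M.dim)))

/-- `D_x L` is an extension of `T_x M` by the line `ℝ 𝕀`. Finite dimension is what later upgrades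
injectivity of `ω_♭` to bijectivity. -/
instance finiteDimensional_gaugeFibre (x : M) : FiniteDimensional ℝ (GaugeFibre L x) := by
  have h1 : (LinearMap.ker (symbol L x)).FG := by
    rw [ker_symbol]
    exact Submodule.fg_span_singleton _
  refine ⟨Submodule.fg_of_fg_map_of_fg_inf_ker (symbol L x) ?_ (by rwa [top_inf_eq])⟩
  exact IsNoetherian.noetherian _

end Derivations

/-! ### `L`-valued 1-forms -/

section OneForms

variable {M : SmoothManifold.{u}} {L : LineBundle.{u, v} M}

/-- The section `θ(X)`. -/
def OneForm.eval (θ : OneForm L) (X : M.VField) : L.Sec := ⟨fun x => θ.toFun x (X x), θ.smooth X⟩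

@[simp] lemma OneForm.eval_apply (θ : OneForm L) (X : M.VField) (x : M) :
    θ.eval X x = θ.toFun x (X x) := rfl

lemma OneForm.compSymbol_eval (θ : OneForm L) (D : LDer L) :
    θ.compSymbol.eval D = θ.eval D.sym := rfl

lemma LDer.op_fsmul (D : LDer L) (f : M.Func) (e : L.Sec) (x : M) :
    D.op (L.fsmul f e) x = dirDeriv D.sym f x • e x + f x • D.op e x := D.leibniz f e x

lemma vbracket_vsmul_right (X Y : M.VField) (f : M.Func) (x : M) :
    vbracket X (M.vsmul f Y) x = dirDeriv X f x • Y x + f x • vbracket X Y x :=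
  VectorField.mlieBracket_smul_right (f.contMDiff.mdifferentiable (by simp) x)
    ((Y.contMDiff x).mdifferentiableAt (by simp))

lemma vbracket_add_right (X Y Z : M.VField) : vbracket X (Y + Z) = vbracket X Y + vbracket X Z := by
  ext1 x
  exact VectorField.mlieBracket_add_right ((Y.contMDiff x).mdifferentiableAt (by simp))
    ((Z.contMDiff x).mdifferentiableAt (by simp))

lemma vbracket_swap (X Y : M.VField) (x : M) : vbracket X Y x = -vbracket Y X x :=
  VectorField.mlieBracket_swap_apply

lemma vbracket_jacobi (X Y Z : M.VField) (x : M) :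
    vbracket X (vbracket Y Z) x = vbracket (vbracket X Y) Z x + vbracket Y (vbracket X Z) x := by
  have : IsManifold (𝓡 M.dim) (minSmoothness ℝ 3) M := isManifold_minSmoothness M 3
  have c2 : ∀ W : M.VField, ContMDiffAt (𝓡 M.dim) (𝓡 M.dim).tangent (minSmoothness ℝ 2)
      (fun y => (⟨y, W y⟩ : TangentBundle (𝓡 M.dim) M)) x := fun W =>
    (W.contMDiff x).of_le (by simpa using ENat.LEInfty.out)
  exact VectorField.leibniz_identity_mlieBracket_apply (c2 X) (c2 Y) (c2 Z)

/-- The value at `x` of the Lie derivative of `θ` along a derivation. -/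
def OneForm.lie (θ : OneForm L) (D : LDer L) (x : M) : M.VField →+ L.fibre x :=
  AddMonoidHom.mk' (fun X => D.op (θ.eval X) x - θ.toFun x (vbracket D.sym X x)) fun X Y => by
    have : θ.eval (X + Y) = θ.eval X + θ.eval Y := by ext y; simp
    rw [this, vbracket_add_right]
    simp only [map_add, ContMDiffSection.coe_add, Pi.add_apply]
    abel

lemma OneForm.lie_apply (θ : OneForm L) (D : LDer L) (x : M) (X : M.VField) :
    θ.lie D x X = D.op (θ.eval X) x - θ.toFun x (vbracket D.sym X x) := rfl

/-- The derivative of `f` appears once through the Leibniz rule of `D` and once through that of the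
bracket, and the two terms cancel. -/
lemma OneForm.lie_vsmul (θ : OneForm L) (D : LDer L) (x : M) (f : M.Func) (X : M.VField) :
    θ.lie D x (M.vsmul f X) = f x • θ.lie D x X := by
  have : θ.eval (M.vsmul f X) = L.fsmul f (θ.eval X) := by
    ext y
    exact map_smul (θ.toFun y) (f y) (X y)
  simp only [OneForm.lie_apply]
  rw [this, vbracket_vsmul_right, LDer.op_fsmul, map_add, map_smul, map_smul, OneForm.eval_apply]
  module

/-- Tensoriality: `η X` is a combination of global fields with coefficients vanishing at `x`, and `η
x = 1`. -/
lemma OneForm.lie_eq_zero (θ : OneForm L) (D : LDer L) (x : M) (X : M.VField) (hX : X x = 0) :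
    θ.lie D x X = 0 := by
  obtain ⟨E, c, η, hη, hc, h⟩ := SmoothManifold.exists_vfield_frame x
  let f : Fin M.dim → M.Func := fun i => ⟨_, hc i X⟩
  have h1 : M.vsmul η X = ∑ i, M.vsmul (f i) (E i) := by
    ext1 y
    have h2 : ⇑(∑ i, M.vsmul (f i) (E i)) = ∑ i, ⇑(M.vsmul (f i) (E i)) :=
      map_sum (ContMDiffSection.coeAddHom _ _ _ _) _ _
    rw [h2, Finset.sum_apply]
    exact (h y (X y)).symm
  have h2 := θ.lie_vsmul D x η X
  rw [hη.self_of_nhds, one_smul] at h2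
  rw [← h2, h1, map_sum]
  refine Finset.sum_eq_zero fun i _ => ?_
  rw [OneForm.lie_vsmul]
  have : f i x = 0 := (congrArg (c i x) hX).trans (map_zero _)
  rw [this, zero_smul]

/-- The differential of `θ ∘ σ`. -/
lemma OneForm.dD_apply (θ : OneForm L) (D₁ D₂ : LDer L) (x : M) :
    θ.compSymbol.dD D₁ D₂ x = θ.lie D₁ x D₂.sym - D₂.op (θ.eval D₁.sym) x := by
  simp only [AtiyahOneForm.dD, OneForm.compSymbol_eval, ContMDiffSection.coe_sub, Pi.sub_apply,
    OneForm.lie_apply]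
  change _ - _ - θ.toFun x (vbracket D₁.sym D₂.sym x) = _
  abel

lemma OneForm.dD_swap (θ : OneForm L) (D₁ D₂ : LDer L) (x : M) :
    θ.compSymbol.dD D₁ D₂ x = -θ.compSymbol.dD D₂ D₁ x := by
  simp only [OneForm.dD_apply, OneForm.lie_apply]
  rw [vbracket_swap, map_neg]
  abel

/-- The Lie derivative term sees only the symbol at `x`, by tensoriality, and the remaining term is
read off from the value of the derivation at `x`. -/
lemma OneForm.dD_congr_right (θ : OneForm L) (D D₁ D₂ : LDer L) {x : M} (h : D₁.at x = D₂.at x) :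
    θ.compSymbol.dD D D₁ x = θ.compSymbol.dD D D₂ x := by
  rw [OneForm.dD_apply, OneForm.dD_apply]
  congr 1
  · rw [← sub_eq_zero, ← map_sub]
    refine θ.lie_eq_zero D x _ ?_
    rw [ContMDiffSection.coe_sub, Pi.sub_apply, sub_eq_zero]
    exact congrArg (symbol L x) h
  · exact congrArg (fun δ : GaugeFibre L x => δ.1.1 (θ.eval D.sym)) h

lemma OneForm.dD_congr (θ : OneForm L) {D₁ D₂ D₁' D₂' : LDer L} {x : M}
    (h₁ : D₁.at x = D₁'.at x) (h₂ : D₂.at x = D₂'.at x) :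
    θ.compSymbol.dD D₁ D₂ x = θ.compSymbol.dD D₁' D₂' x := by
  rw [θ.dD_congr_right D₁ D₂ D₂' h₂, θ.dD_swap, θ.dD_congr_right D₂' D₁ D₁' h₁, ← θ.dD_swap]

end OneForms

/-! ### The 2-form `d_D (θ ∘ σ)` -/

section TwoForms

variable {M : SmoothManifold.{u}} {L : LineBundle.{u, v} M}

lemma AtiyahTwoForm.ext {w w' : AtiyahTwoForm L}
    (h : ∀ D D' : LDer L, w.eval D D' = w'.eval D D') : w = w' := by
  have : w.toFun = w'.toFun := by
    funext x
    refine LinearMap.ext₂ fun δ ε => ?_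
    obtain ⟨D, rfl⟩ := exists_LDer_at δ
    obtain ⟨E, rfl⟩ := exists_LDer_at ε
    exact congrArg (fun s : L.Sec => s x) (h D E)
  cases w
  cases w'
  congr

lemma OneForm.lie_smul (θ : OneForm L) (D : LDer L) (x : M) (c : ℝ) (X : M.VField) :
    θ.lie D x (c • X) = c • θ.lie D x X :=
  θ.lie_vsmul D x (⟨fun _ => c, contMDiff_const⟩ : M.Func) X

lemma OneForm.lie_congr (θ : OneForm L) (D : LDer L) {x : M} {X Y : M.VField} (h : X x = Y x) :
    θ.lie D x X = θ.lie D x Y := by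
  rw [← sub_eq_zero, ← map_sub]
  refine θ.lie_eq_zero D x _ ?_
  rw [ContMDiffSection.coe_sub, Pi.sub_apply, sub_eq_zero, h]

lemma OneForm.dD_add_right (θ : OneForm L) (E : LDer L) {D D₁ D₂ : LDer L} {x : M}
    (h : D.at x = D₁.at x + D₂.at x) :
    θ.compSymbol.dD E D x = θ.compSymbol.dD E D₁ x + θ.compSymbol.dD E D₂ x := by
  have h1 : θ.lie E x D.sym = θ.lie E x (D₁.sym + D₂.sym) :=
    θ.lie_congr E (congrArg (symbol L x) h)
  have h2 : ∀ e, D.op e x = D₁.op e x + D₂.op e x := fun e =>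
    congrArg (fun δ : GaugeFibre L x => δ.1.1 e) h
  rw [OneForm.dD_apply, OneForm.dD_apply, OneForm.dD_apply, h1, map_add, h2]
  abel

lemma OneForm.dD_smul_right (θ : OneForm L) (E : LDer L) {D D₁ : LDer L} {x : M} (c : ℝ)
    (h : D.at x = c • D₁.at x) :
    θ.compSymbol.dD E D x = c • θ.compSymbol.dD E D₁ x := by
  have h1 : θ.lie E x D.sym = θ.lie E x (c • D₁.sym) := θ.lie_congr E (congrArg (symbol L x) h)
  have h2 : ∀ e, D.op e x = c • D₁.op e x := fun e =>
    congrArg (fun δ : GaugeFibre L x => δ.1.1 e) h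
  rw [OneForm.dD_apply, OneForm.dD_apply, h1, OneForm.lie_smul, h2, smul_sub]

/-- A derivation extending a given element of the gauge algebroid. -/
def extend {x : M} (δ : GaugeFibre L x) : LDer L := (exists_LDer_at δ).choose

@[simp] lemma extend_at {x : M} (δ : GaugeFibre L x) : (extend δ).at x = δ :=
  (exists_LDer_at δ).choose_spec

/-- The bilinear map underlying `d_D (θ ∘ σ)`. -/
def OneForm.twoFormAt (θ : OneForm L) (x : M) :
    GaugeFibre L x →ₗ[ℝ] GaugeFibre L x →ₗ[ℝ] L.fibre x :=
  LinearMap.mk₂ ℝ (fun δ ε => θ.compSymbol.dD (extend δ) (extend ε) x)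
    (fun a b c => by
      rw [θ.dD_swap, θ.dD_add_right (D₁ := extend a) (D₂ := extend b) _ (by simp), neg_add,
        ← θ.dD_swap, ← θ.dD_swap])
    (fun r a b => by
      rw [θ.dD_swap, θ.dD_smul_right (D₁ := extend a) _ r (by simp), ← smul_neg, ← θ.dD_swap])
    (fun a b c => θ.dD_add_right _ (by simp))
    (fun r a b => θ.dD_smul_right _ r (by simp))

lemma OneForm.twoFormAt_at (θ : OneForm L) (D E : LDer L) (x : M) :
    θ.twoFormAt x (D.at x) (E.at x) = θ.compSymbol.dD D E x :=
  θ.dD_congr (extend_at _) (extend_at _)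

/-- The Atiyah 2-form `d_D (θ ∘ σ)`. -/
def OneForm.twoForm (θ : OneForm L) : AtiyahTwoForm L where
  toFun := θ.twoFormAt
  alternating x δ := by
    have h : θ.twoFormAt x δ δ = -θ.twoFormAt x δ δ := θ.dD_swap _ _ x
    have h2 : (2 : ℝ) • θ.twoFormAt x δ δ = 0 := by rw [two_smul]; exact add_eq_zero_iff_eq_neg.2 h
    exact (smul_eq_zero.1 h2).resolve_left two_ne_zero
  smooth D E := by
    have h : (fun x => θ.twoFormAt x (D.at x) (E.at x)) = θ.compSymbol.dD D E :=
      funext fun x => θ.twoFormAt_at D E x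
    change L.IsSmooth (fun x => θ.twoFormAt x (D.at x) (E.at x))
    rw [h]
    exact (θ.compSymbol.dD D E).contMDiff

lemma OneForm.twoForm_eval (θ : OneForm L) (D E : LDer L) :
    θ.twoForm.eval D E = θ.compSymbol.dD D E := by
  ext x
  exact θ.twoFormAt_at D E x

/-- This is `d_D² = 0`. Terms with two derivations acting cancel against the commutators; the double
brackets enter only through their symbols, so the Jacobi identity for vector fields disposes of
them. -/
lemma OneForm.twoForm_dD (θ : OneForm L) (D₁ D₂ D₃ : LDer L) : θ.twoForm.dD D₁ D₂ D₃ = 0 := by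
  have hJ : θ.compSymbol.eval ((D₁.bracket D₂).bracket D₃) -
      θ.compSymbol.eval ((D₁.bracket D₃).bracket D₂) +
      θ.compSymbol.eval ((D₂.bracket D₃).bracket D₁) = 0 := by
    ext x
    have h := vbracket_jacobi D₁.sym D₂.sym D₃.sym x
    rw [vbracket_swap D₁.sym (vbracket D₂.sym D₃.sym), vbracket_swap D₂.sym] at h
    have h2 := congrArg (θ.toFun x) h
    simp only [map_add, map_neg] at h2
    simp only [OneForm.compSymbol_eval, ContMDiffSection.coe_sub, ContMDiffSection.coe_add,
      Pi.add_apply, Pi.sub_apply, OneForm.eval_apply, ContMDiffSection.coe_zero, Pi.zero_apply]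
    change θ.toFun x (vbracket (vbracket D₁.sym D₂.sym) D₃.sym x) -
      θ.toFun x (vbracket (vbracket D₁.sym D₃.sym) D₂.sym x) +
      θ.toFun x (vbracket (vbracket D₂.sym D₃.sym) D₁.sym x) = 0
    rw [← neg_eq_iff_eq_neg.2 h2.symm]
    abel
  have hb : ∀ (D E : LDer L) (e : L.Sec), (D.bracket E).op e = D.op (E.op e) - E.op (D.op e) :=
    fun _ _ _ => rfl
  simp only [AtiyahTwoForm.dD, OneForm.twoForm_eval, AtiyahOneForm.dD, map_sub, hb]
  rw [← hJ]
  abel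

/-- `d_D (θ ∘ σ) (𝕀, -) = θ ∘ σ`. -/
lemma OneForm.twoFormAt_identity (θ : OneForm L) (x : M) (ε : GaugeFibre L x) :
    θ.twoFormAt x (identityAt L x) ε = θ.toFun x (symbol L x ε) := by
  obtain ⟨E, rfl⟩ := exists_LDer_at ε
  rw [← LDer.identity_at, θ.twoFormAt_at, θ.dD_apply, θ.lie_apply]
  have h1 : θ.eval (LDer.identity L).sym = 0 := by
    ext y
    exact map_zero (θ.toFun y)
  have h2 : vbracket (LDer.identity L).sym E.sym x = 0 :=
    congrFun VectorField.mlieBracket_zero_left x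
  rw [h1, h2, map_zero, map_zero, sub_zero]
  exact sub_zero _

/-- On fields in the kernel of `θ`, the form `d_D (θ ∘ σ)` is minus the curvature. -/
lemma OneForm.twoFormAt_of_ker (θ : OneForm L) {X Y : M.VField} (hX : ∀ y, θ.toFun y (X y) = 0)
    (hY : ∀ y, θ.toFun y (Y y) = 0) {x : M} {δ ε : GaugeFibre L x} (hδ : X x = symbol L x δ)
    (hε : Y x = symbol L x ε) :
    θ.twoFormAt x δ ε = -θ.toFun x (vbracket X Y x) := by
  -- The extensions have symbols `η X` and `ζ Y`, not `X` and `Y`. This is harmless: `η` and `ζ` are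
  -- `1` at `x`, and the derivative of `η` multiplies `θ(X) = 0`.
  obtain ⟨D, η, rfl, hη, hD⟩ := exists_LDer δ X hδ
  obtain ⟨E, ζ, rfl, hζ, hE⟩ := exists_LDer ε Y hε
  have h1 : θ.eval (M.vsmul η X) = 0 := by
    ext y
    exact (map_smul (θ.toFun y) (η y) (X y)).trans (by rw [hX, smul_zero]; rfl)
  have h2 : θ.eval Y = 0 := by
    ext y
    exact hY y
  rw [θ.twoFormAt_at, θ.dD_apply, hD, hE, h1, map_zero, θ.lie_vsmul, hζ, one_smul, θ.lie_apply, h2,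
    map_zero, hD, vbracket_swap, vbracket_vsmul_right, hη, one_smul, map_neg, map_add, map_smul,
    hX, smul_zero, zero_add, vbracket_swap Y X, map_neg]
  simp

end TwoForms

/-! ### The kernel of a 1-form -/

section Kernel

variable {M : SmoothManifold.{u}} {L : LineBundle.{u, v} M}

/-- The distribution `ker θ`. -/
def OneForm.ker (θ : OneForm L) (x : M) : Submodule ℝ (M.Tangent x) := LinearMap.ker (θ.toFun x)

lemma OneForm.surjective_of_ne_zero (θ : OneForm L) {x : M} {w : M.Tangent x}
    (hw : θ.toFun x w ≠ 0) : Function.Surjective (θ.toFun x) := fun l => by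
  obtain ⟨c, hc⟩ := (finrank_eq_one_iff_of_nonzero' _ hw).1 (L.finrank_fibre x) l
  exact ⟨c • w, by rw [map_smul, hc]⟩

/-- The vector field `φ(θ(R)) V - φ(θ(V)) R` in the kernel of `θ`. -/
def OneForm.proj (θ : OneForm L) (φ : L.Dual) (R V : M.VField) : M.VField :=
  M.vsmul (φ.eval (θ.eval R)) V - M.vsmul (φ.eval (θ.eval V)) R

lemma OneForm.proj_apply (θ : OneForm L) (φ : L.Dual) (R V : M.VField) (x : M) :
    θ.proj φ R V x =
      φ.toFun x (θ.toFun x (R x)) • V x - φ.toFun x (θ.toFun x (V x)) • R x := rfl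

lemma OneForm.proj_mem_ker (θ : OneForm L) (φ : L.Dual) (R V : M.VField) (x : M) :
    θ.toFun x (θ.proj φ R V x) = 0 := by
  rw [θ.proj_apply, map_sub, map_smul, map_smul, LineBundle.dual_smul_comm, sub_self]

lemma OneForm.exists_dual (θ : OneForm L) {x : M} (h : Function.Surjective (θ.toFun x)) :
    ∃ (φ : L.Dual) (R : M.VField), φ.toFun x (θ.toFun x (R x)) = 1 := by
  obtain ⟨φ, e, he⟩ := L.exists_dual x
  obtain ⟨w, hw⟩ := h (e x)
  obtain ⟨R, rfl⟩ := SmoothManifold.exists_vfield x w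
  exact ⟨φ, R, by rw [hw, he]⟩

lemma OneForm.exists_section_ker (θ : OneForm L) {x : M} (h : Function.Surjective (θ.toFun x))
    {w : M.Tangent x} (hw : θ.toFun x w = 0) : ∃ X : DistSec θ.ker, X.1 x = w := by
  obtain ⟨φ, R, hR⟩ := θ.exists_dual h
  obtain ⟨V, rfl⟩ := SmoothManifold.exists_vfield x w
  refine ⟨⟨θ.proj φ R V, θ.proj_mem_ker φ R V⟩, ?_⟩
  rw [θ.proj_apply, hR, hw, map_zero, zero_smul, one_smul, sub_zero]

/-- Local spanning fields come from projecting a frame into `ker θ` along `R`, wherever `φ(θ(R)) ≠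
0`; on `ker θ` this projection is multiplication by `φ(θ(R))`. -/
lemma OneForm.isHyperplaneDistribution (θ : OneForm L)
    (h : ∀ x, Function.Surjective (θ.toFun x)) : IsHyperplaneDistribution θ.ker := by
  refine ⟨fun x => ?_, fun x => ?_⟩
  · rw [← L.finrank_fibre x]
    exact ((θ.toFun x).quotKerEquivOfSurjective (h x)).finrank_eq
  · obtain ⟨E, c, η, hη, -, hE⟩ := SmoothManifold.exists_vfield_frame x
    obtain ⟨φ, R, hR⟩ := θ.exists_dual (h x)
    obtain ⟨U, hU, hUo, hxU⟩ := eventually_nhds_iff.1 hη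
    have hf : Continuous (φ.eval (θ.eval R)) := (φ.eval (θ.eval R)).contMDiff.continuous
    refine ⟨U ∩ {y | φ.eval (θ.eval R) y ≠ 0}, hUo.inter (isOpen_ne.preimage hf),
      ⟨hxU, by simp [hR]⟩, M.dim, fun i => θ.proj φ R (E i),
      fun i => (θ.proj φ R (E i)).contMDiff.contMDiffOn, fun y hy => le_antisymm ?_ ?_⟩
    · intro w hw
      have hw' : θ.toFun y w = 0 := hw
      have h1 := hE y w
      rw [hU y hy.1, one_smul] at h1
      have h2 : ∑ i, c i y w • θ.proj φ R (E i) y = φ.toFun y (θ.toFun y (R y)) • w := by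
        have h3 : ∑ i, c i y w • φ.toFun y (θ.toFun y (E i y)) = 0 := by
          have := congrArg (fun w => φ.toFun y (θ.toFun y w)) h1
          simpa [map_sum, hw'] using this
        simp only [θ.proj_apply, smul_sub, Finset.sum_sub_distrib]
        conv_rhs => rw [← h1]
        rw [Finset.smul_sum, sub_eq_iff_eq_add]
        have h4 : ∑ i, c i y w • φ.toFun y (θ.toFun y (E i y)) • R y = 0 := by
          rw [← zero_smul ℝ (R y), ← h3, Finset.sum_smul]
          exact Finset.sum_congr rfl fun i _ => by rw [smul_assoc]
        rw [h4, add_zero]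
        exact Finset.sum_congr rfl fun i _ => smul_comm _ _ _
      have h5 : w = (φ.toFun y (θ.toFun y (R y)))⁻¹ • ∑ i, c i y w • θ.proj φ R (E i) y := by
        
        have h6 : φ.toFun y (θ.toFun y (R y)) ≠ 0 := hy.2
        rw [h2, smul_smul, inv_mul_cancel₀ h6, one_smul]
      rw [h5]
      exact Submodule.smul_mem _ _ (Submodule.sum_mem _ fun i _ =>
        Submodule.smul_mem _ _ (Submodule.subset_span ⟨i, rfl⟩))
    · rw [Submodule.span_le]
      rintro _ ⟨i, rfl⟩
      exact θ.proj_mem_ker φ R (E i) y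

lemma OneForm.curvature_eq_zero_iff (θ : OneForm L) (X Y : DistSec θ.ker) (x : M) :
    curvature θ.ker X Y x = 0 ↔ θ.toFun x (vbracket X.1 Y.1 x) = 0 := by
  change (θ.ker x).mkQ _ = 0 ↔ _
  rw [Submodule.mkQ_apply, Submodule.Quotient.mk_eq_zero]
  rfl

lemma bijective_of_injective_of_finrank_eq_one {V W : Type*} [AddCommGroup V] [Module ℝ V]
    [FiniteDimensional ℝ V] [AddCommGroup W] [Module ℝ W] (hW : Module.finrank ℝ W = 1)
    {f : V →ₗ[ℝ] V →ₗ[ℝ] W} (hf : Function.Injective f) : Function.Bijective f := by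
  have : FiniteDimensional ℝ W := Module.finite_of_finrank_eq_succ hW
  refine ⟨hf, (LinearMap.injective_iff_surjective_of_finrank_eq_finrank ?_).1 hf⟩
  rw [Module.finrank_linearMap, hW, mul_one]

/-- `ker θ` is a contact structure iff `d_D (θ ∘ σ)` is non-degenerate. -/
lemma OneForm.isContact_iff (θ : OneForm L) (h : ∀ x, Function.Surjective (θ.toFun x)) :
    IsContact θ.ker ↔ θ.twoForm.IsSymplectic := by
  constructor
  · intro hc
    refine ⟨θ.twoForm_dD, fun x => ?_⟩
    have hinj : Function.Injective (θ.twoFormAt x) := by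
      rw [injective_iff_map_eq_zero]
      intro δ hδ
      -- By skew-symmetry `θ(σ δ) = ω(𝕀, δ) = -ω(δ, 𝕀) = 0`, so `σ δ` lies in the distribution and
      -- the contact condition applies to it.
      have h0 : θ.toFun x (symbol L x δ) = 0 := by
        rw [← θ.twoFormAt_identity, ← neg_eq_zero]
        have h1 := θ.twoForm.alternating x (identityAt L x + δ)
        have h2 := θ.twoForm.alternating x (identityAt L x)
        change θ.twoFormAt x _ _ = 0 at h1 h2
        rw [map_add (θ.twoFormAt x), hδ, add_zero, map_add, h2, zero_add] at h1
        rw [h1, neg_zero]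
      have hs : symbol L x δ = 0 := hc.2 x _ h0 fun X Y hX => by
        obtain ⟨ε, hε⟩ := symbol_surjective L x (Y.1 x)
        have := θ.twoFormAt_of_ker X.2 Y.2 hX hε.symm
        rw [hδ, LinearMap.zero_apply] at this
        rw [θ.curvature_eq_zero_iff]
        exact neg_eq_zero.1 this.symm
      -- What remains is `δ = c 𝕀`, and `c = 0` because `ω(𝕀, -) = θ ∘ σ` is non-zero.
      obtain ⟨c, rfl⟩ := exists_smul_identityAt hs
      obtain ⟨φ, e, he⟩ := L.exists_dual x
      obtain ⟨w, hw⟩ := h x (e x)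
      obtain ⟨ε, rfl⟩ := symbol_surjective L x w
      have h3 : θ.twoFormAt x (c • identityAt L x) ε = 0 := by rw [hδ]; rfl
      rw [map_smul, LinearMap.smul_apply, θ.twoFormAt_identity, hw] at h3
      rcases smul_eq_zero.1 h3 with h3 | h3
      · rw [h3, zero_smul]
      · rw [h3, map_zero] at he
        exact absurd he zero_ne_one
    exact bijective_of_injective_of_finrank_eq_one (L.finrank_fibre x) hinj
  · intro hs
    refine ⟨θ.isHyperplaneDistribution h, fun x w hw hcurv => ?_⟩
    obtain ⟨δ, rfl⟩ := symbol_surjective L x w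
    have h1 : ∀ ε, θ.toFun x (symbol L x ε) = 0 → θ.twoFormAt x δ ε = 0 := fun ε hε => by
      obtain ⟨X, hX⟩ := θ.exists_section_ker (h x) hw
      obtain ⟨Y, hY⟩ := θ.exists_section_ker (h x) hε
      rw [θ.twoFormAt_of_ker X.2 Y.2 hX hY,
        (θ.curvature_eq_zero_iff X Y x).1 (hcurv X Y hX), neg_zero]
    obtain ⟨φ, R, hR⟩ := θ.exists_dual (h x)
    obtain ⟨ρ, hρ⟩ := symbol_surjective L x (R x)
    -- Since `ω(δ, -)` vanishes on the kernel of `θ ∘ σ`, it is a multiple of `θ ∘ σ = ω(𝕀, -)`, the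
    -- factor being found by evaluating at `ρ`, where `φ(θ(σ ρ)) = 1`. Non-degeneracy turns this
    -- into `δ ∈ ℝ 𝕀`, so the symbol of `δ` is zero.
    have h2 : δ = φ.toFun x (θ.twoFormAt x δ ρ) • identityAt L x := by
      refine (hs.2 x).1 (LinearMap.ext fun ε => ?_)
      change θ.twoFormAt x δ ε = θ.twoFormAt x _ ε
      rw [map_smul, LinearMap.smul_apply, θ.twoFormAt_identity]
      have h3 := h1 (ε - φ.toFun x (θ.toFun x (symbol L x ε)) • ρ) (by
        rw [map_sub, map_smul, map_sub, map_smul, hρ, LineBundle.dual_smul_comm, hR, one_smul,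
          sub_self])
      rw [map_sub, map_smul, sub_eq_zero] at h3
      rw [h3, LineBundle.dual_smul_comm]
    rw [h2, map_smul, symbol_identityAt, smul_zero]

end Kernel

/-! ### The 1-form of a symplectic Atiyah form -/

section OfTwoForm

variable {M : SmoothManifold.{u}} {L : LineBundle.{u, v} M}

/-- `ω(𝕀, -)` kills `𝕀`, which spans `ker σ`, so composing it with any pointwise linear right
inverse of `σ` gives the descended form. -/
lemma exists_oneForm (w : AtiyahTwoForm L) :
    ∃ θ : OneForm L, ∀ x ε, θ.toFun x (symbol L x ε) = w.toFun x (identityAt L x) ε := by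
  have hs : ∀ x, ∃ s : M.Tangent x →ₗ[ℝ] GaugeFibre L x, (symbol L x).comp s = LinearMap.id :=
    fun x => LinearMap.exists_rightInverse_of_surjective _
      (LinearMap.range_eq_top.2 (symbol_surjective L x))
  choose s hs using hs
  have key : ∀ x ε, w.toFun x (identityAt L x) (s x (symbol L x ε)) =
      w.toFun x (identityAt L x) ε := fun x ε => by
    obtain ⟨c, hc⟩ := exists_smul_identityAt (δ := s x (symbol L x ε) - ε) (by
      rw [map_sub, sub_eq_zero]
      exact LinearMap.congr_fun (hs x) _)
    rw [← sub_eq_zero, ← map_sub, hc, map_smul, w.alternating, smul_zero]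
  refine ⟨⟨fun x => (w.toFun x (identityAt L x)).comp (s x), fun X x => ?_⟩, key⟩
  obtain ⟨δ, hδ⟩ := symbol_surjective L x (X x)
  -- The right inverses `s x` need not vary smoothly. Smoothness is tested instead on a derivation
  -- with symbol `η X`, dividing by `η` near `x`.
  obtain ⟨D, η, -, hη, hD⟩ := exists_LDer δ X hδ.symm
  have h1 : ∀ y, (w.interiorId.eval D) y =
      η y • w.toFun y (identityAt L y) (s y (X y)) := fun y => by
    rw [← map_smul, ← map_smul]
    have : η y • X y = symbol L y (D.at y) := by rw [LDer.symbol_at, hD]; rfl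
    rw [this, key]
    rfl
  have h2 : ∀ᶠ y in nhds x, η y ≠ 0 :=
    η.contMDiff.continuous.continuousAt.eventually_ne (by rw [hη]; exact one_ne_zero)
  have h3 := ((η.contMDiff x).inv₀ (by rw [hη]; exact one_ne_zero)).smul_section
    ((w.interiorId.eval D).contMDiff x)
  refine h3.congr_of_eventuallyEq ?_
  filter_upwards [h2] with y hy
  refine congrArg (Bundle.TotalSpace.mk' ℝ y) ?_
  change w.toFun y (identityAt L y) (s y (X y)) = (η y)⁻¹ • (w.interiorId.eval D) y
  rw [h1, smul_smul, inv_mul_cancel₀ hy, one_smul]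

/-- The 1-form `θ` with `θ ∘ σ = ι_𝕀 ω`. -/
def AtiyahTwoForm.oneForm (w : AtiyahTwoForm L) : OneForm L := (exists_oneForm w).choose

lemma AtiyahTwoForm.oneForm_symbol (w : AtiyahTwoForm L) (x : M) (ε : GaugeFibre L x) :
    w.oneForm.toFun x (symbol L x ε) = w.toFun x (identityAt L x) ε :=
  (exists_oneForm w).choose_spec x ε

lemma AtiyahOneForm.ext_toFun {Θ Θ' : AtiyahOneForm L} (h : Θ.toFun = Θ'.toFun) : Θ = Θ' := by
  cases Θ
  cases Θ'
  congr

lemma AtiyahTwoForm.oneForm_compSymbol (w : AtiyahTwoForm L) :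
    w.oneForm.compSymbol = w.interiorId :=
  AtiyahOneForm.ext_toFun (funext fun x => LinearMap.ext fun ε => w.oneForm_symbol x ε)

lemma AtiyahTwoForm.compSymbol_eq_interiorId_iff (w : AtiyahTwoForm L) (η : OneForm L) :
    η.compSymbol = w.interiorId ↔ η = w.oneForm := by
  refine ⟨fun h => ?_, fun h => h ▸ w.oneForm_compSymbol⟩
  rw [← w.oneForm_compSymbol] at h
  ext x t
  obtain ⟨ε, rfl⟩ := symbol_surjective L x t
  have h' := congrArg AtiyahOneForm.toFun h
  exact LinearMap.congr_fun (congrFun h' x) ε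

/-- In `d_D ω(𝕀, D₁, D₂)` the terms with `[𝕀, Dᵢ]` vanish and `𝕀` acts as the identity; what is left
is `ω(D₁, D₂) - d_D(ι_𝕀 ω)(D₁, D₂)`. -/
lemma AtiyahTwoForm.eval_eq_dD_oneForm {w : AtiyahTwoForm L} (hw : ∀ D₁ D₂ D₃, w.dD D₁ D₂ D₃ = 0)
    (D₁ D₂ : LDer L) : w.eval D₁ D₂ = w.oneForm.compSymbol.dD D₁ D₂ := by
  have h := hw (LDer.identity L) D₁ D₂
  have h1 : ∀ D, w.eval (LDer.identity L) D = w.oneForm.compSymbol.eval D := fun D => by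
    rw [w.oneForm_compSymbol]
    rfl
  have h2 : ∀ D E, w.eval ((LDer.identity L).bracket D) E = 0 := fun D E => by
    have h0 : ∀ x, ((LDer.identity L).bracket D).at x = 0 := fun x => by
      refine Subtype.ext (Prod.ext (LinearMap.ext fun e => ?_) ?_)
      · exact sub_self (D.op e x)
      · exact congrFun VectorField.mlieBracket_zero_left x
    ext x
    change w.toFun x (((LDer.identity L).bracket D).at x) (E.at x) = 0
    rw [h0, map_zero, LinearMap.zero_apply]
  have h3 : ∀ D E, w.eval D E = -w.eval E D := fun D E => by
    ext x
    exact (LinearMap.IsAlt.neg (w.alternating x) (E.at x) (D.at x)).symm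
  rw [AtiyahTwoForm.dD, h2, h2, h3 _ (LDer.identity L), h1, h1, h1] at h
  rw [AtiyahOneForm.dD, ← sub_eq_zero, ← h]
  change w.eval D₁ D₂ - _ = w.eval D₁ D₂ - _ + _ - _ + _ - _
  abel

lemma AtiyahTwoForm.eq_twoForm_oneForm {w : AtiyahTwoForm L}
    (hw : ∀ D₁ D₂ D₃, w.dD D₁ D₂ D₃ = 0) : w = w.oneForm.twoForm :=
  AtiyahTwoForm.ext fun D D' => by rw [OneForm.twoForm_eval, AtiyahTwoForm.eval_eq_dD_oneForm hw]

lemma OneForm.twoForm_oneForm (θ : OneForm L) : θ.twoForm.oneForm = θ := by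
  symm
  rw [← AtiyahTwoForm.compSymbol_eq_interiorId_iff]
  exact AtiyahOneForm.ext_toFun
    (funext fun x => LinearMap.ext fun ε => (θ.twoFormAt_identity x ε).symm)

/-- As `𝕀` is nowhere zero, non-degeneracy gives `ω(𝕀, -) ≠ 0`, and a non-zero map to a line is
onto. -/
lemma AtiyahTwoForm.IsSymplectic.oneForm_surjective {w : AtiyahTwoForm L} (hw : w.IsSymplectic)
    (x : M) : Function.Surjective (w.oneForm.toFun x) := by
  obtain ⟨ε, hε⟩ : ∃ ε, w.toFun x (identityAt L x) ε ≠ 0 := by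
    by_contra! h
    refine identityAt_ne_zero (L := L) x ((hw.2 x).1 ?_)
    rw [map_zero]
    exact LinearMap.ext h
  rw [← w.oneForm_symbol] at hε
  exact w.oneForm.surjective_of_ne_zero hε

lemma AtiyahTwoForm.IsSymplectic.isContact {w : AtiyahTwoForm L} (hw : w.IsSymplectic) :
    IsContact w.oneForm.ker := by
  rw [OneForm.isContact_iff _ hw.oneForm_surjective, ← eq_twoForm_oneForm hw.1]
  exact hw

end OfTwoForm

/-! ### Transport along diffeomorphisms -/

section Transport

variable {M N : SmoothManifold.{u}}

/-- Formulated in the total space because `φ.symm (φ x)` and `x` are only propositionally equal, so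
their tangent spaces are different types. -/
lemma Diffeo.d_symm_d (φ : Diffeo M N) (x : M) (w : M.Tangent x) :
    (⟨φ.symm (φ x), Diffeo.d (φ.symm : Diffeo N M) (φ x) (φ.d x w)⟩ : TangentBundle (𝓡 M.dim) M) =
      ⟨x, w⟩ := by
  have h1 : (φ.trans φ.symm : Diffeo M M) = Diffeomorph.refl (𝓡 M.dim) M ∞ := by
    ext y
    exact φ.symm_apply_apply y
  have h2 : ∀ ψ : Diffeo M M, ψ = Diffeomorph.refl (𝓡 M.dim) M ∞ →
      (⟨ψ x, ψ.d x w⟩ : TangentBundle (𝓡 M.dim) M) = ⟨x, w⟩ := by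
    rintro _ rfl
    exact congrArg (Bundle.TotalSpace.mk' _ x) (Diffeo.d_refl x w)
  rw [← h2 _ h1]
  exact congrArg (Bundle.TotalSpace.mk' _ _) (Diffeo.d_trans φ φ.symm x w).symm

lemma Diffeo.isInvertible_mfderiv (φ : Diffeo M N) (x : M) :
    (mfderiv (𝓡 M.dim) (𝓡 N.dim) φ x).IsInvertible :=
  ⟨φ.mfderivToContinuousLinearEquiv (by simp) x, φ.mfderivToContinuousLinearEquiv_coe (by simp)⟩

/-- The push-forward of a vector field. -/
def Diffeo.pushField (φ : Diffeo M N) (X : M.VField) : N.VField :=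
  ⟨VectorField.mpullback (𝓡 N.dim) (𝓡 M.dim) φ.symm X,
    ContMDiff.mpullback_vectorField (n := ∞) X.contMDiff φ.symm.contMDiff
      (Diffeo.isInvertible_mfderiv (φ.symm : Diffeo N M)) (by simp)⟩

lemma Diffeo.pushField_apply (φ : Diffeo M N) (X : M.VField) (x : M) :
    φ.pushField X (φ x) = φ.d x (X x) := by
  have h1 := φ.d_symm_d x (X x)
  have h2 : (⟨x, X x⟩ : TangentBundle (𝓡 M.dim) M) = ⟨φ.symm (φ x), X (φ.symm (φ x))⟩ := by
    rw [φ.symm_apply_apply]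
  have h3 : Diffeo.d (φ.symm : Diffeo N M) (φ x) (φ.d x (X x)) = X (φ.symm (φ x)) :=
    Bundle.TotalSpace.mk_inj.1 (h1.trans h2)
  change (mfderiv (𝓡 N.dim) (𝓡 M.dim) φ.symm (φ x)).inverse (X (φ.symm (φ x))) = _
  rw [← h3]
  exact (Diffeo.isInvertible_mfderiv (φ.symm : Diffeo N M) (φ x)).inverse_apply_self _

lemma Diffeo.vbracket_pushField (φ : Diffeo M N) (X Y : M.VField) (x : M) :
    vbracket (φ.pushField X) (φ.pushField Y) (φ x) = φ.d x (vbracket X Y x) := by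
  rw [← φ.pushField_apply]
  have : IsManifold (𝓡 M.dim) (minSmoothness ℝ 3) M := isManifold_minSmoothness M 3
  have : IsManifold (𝓡 N.dim) (minSmoothness ℝ 3) N := isManifold_minSmoothness N 3
  have : IsManifold (𝓡 M.dim) (minSmoothness ℝ 2) M := isManifold_minSmoothness M 2
  have : IsManifold (𝓡 N.dim) (minSmoothness ℝ 2) N := isManifold_minSmoothness N 2
  exact (VectorField.mpullback_mlieBracket (n := ∞)
    ((X.contMDiff _).mdifferentiableAt (by simp)) ((Y.contMDiff _).mdifferentiableAt (by simp))
    (φ.symm.contMDiff _) (by simpa using ENat.LEInfty.out)).symm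

end Transport

namespace LineBundleIso

variable {M M' : SmoothManifold.{u}} {L : LineBundle.{u, v} M} {L' : LineBundle.{u, v} M'}

lemma pullback_apply (F : LineBundleIso L L') (e : L'.Sec) (x : M) :
    F.fibre x (F.pullback e x) = e (F.base x) := (F.fibre x).apply_symm_apply _

lemma pullback_bijective (F : LineBundleIso L L') : Function.Bijective F.pullback := by
  constructor
  · intro a b h
    ext y
    obtain ⟨x, rfl⟩ : ∃ x, F.base x = y := F.base.surjective y
    rw [← F.pullback_apply, h, F.pullback_apply]
  · intro e
    have h : ∀ y, ∃ l : L'.fibre y, F.total ⟨F.base.symm y, e (F.base.symm y)⟩ = ⟨y, l⟩ := by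
      intro y
      obtain ⟨x, rfl⟩ : ∃ x, F.base x = y := F.base.surjective y
      rw [F.base.symm_apply_apply]
      exact ⟨_, F.total_mk _ _⟩
    choose s hs using h
    have hsm : L'.IsSmooth s := by
      have : (fun y => Bundle.TotalSpace.mk' ℝ y (s y)) =
          fun y => F.total ⟨F.base.symm y, e (F.base.symm y)⟩ := funext fun y => (hs y).symm
      rw [LineBundle.IsSmooth, this]
      exact F.total.contMDiff.comp (e.contMDiff.comp F.base.symm.contMDiff)
    refine ⟨⟨s, hsm⟩, ?_⟩
    ext x
    refine (F.fibre x).injective ?_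
    rw [F.pullback_apply]
    have h1 := hs (F.base x)
    rw [F.base.symm_apply_apply, F.total_mk] at h1
    exact (Bundle.TotalSpace.mk_inj.1 h1).symm

/-- The push-forward of derivations. -/
def pushDer (F : LineBundleIso L L') (D : LDer L) : LDer L' :=
  have key : ∀ (e : L'.Sec) (x : M),
      (LinearEquiv.ofBijective F.pullback F.pullback_bijective).symm (D.op (F.pullback e))
        (F.base x) = (F.push x (D.at x)).1.1 e := fun e x => by
    rw [← F.pullback_apply]
    have := (LinearEquiv.ofBijective F.pullback F.pullback_bijective).apply_symm_apply
      (D.op (F.pullback e))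
    exact congrArg (fun s : L.Sec => F.fibre x (s x)) this
  { op := (LinearEquiv.ofBijective F.pullback F.pullback_bijective).symm.toLinearMap.comp
      (D.op.comp F.pullback)
    sym := F.base.pushField D.sym
    leibniz := fun f e y => by
      obtain ⟨x, rfl⟩ : ∃ x, F.base x = y := F.base.surjective y
      have h := (F.push x (D.at x)).2 f e
      rw [Diffeo.pushField_apply]
      exact (key _ x).trans (h.trans (congrArg _ (congrArg _ (key _ x).symm))) }

lemma pushDer_op (F : LineBundleIso L L') (D : LDer L) (e : L'.Sec) (x : M) :
    (F.pushDer D).op e (F.base x) = F.fibre x (D.op (F.pullback e) x) := by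
  rw [← F.pullback_apply]
  have := (LinearEquiv.ofBijective F.pullback F.pullback_bijective).apply_symm_apply
    (D.op (F.pullback e))
  exact congrArg (fun s : L.Sec => F.fibre x (s x)) this

lemma pushDer_sym (F : LineBundleIso L L') (D : LDer L) :
    (F.pushDer D).sym = F.base.pushField D.sym := rfl

lemma pushDer_at (F : LineBundleIso L L') (D : LDer L) (x : M) :
    (F.pushDer D).at (F.base x) = F.push x (D.at x) :=
  Subtype.ext (Prod.ext (LinearMap.ext fun e => F.pushDer_op D e x)
    (F.base.pushField_apply D.sym x))

lemma push_identityAt (F : LineBundleIso L L') (x : M) :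
    F.push x (identityAt L x) = identityAt L' (F.base x) :=
  Subtype.ext (Prod.ext (LinearMap.ext fun e => F.pullback_apply e x) (map_zero _))

/-- An isomorphism compatible with the 1-forms `θ`, `θ'` is compatible with `d_D (θ ∘ σ)` and
`d_D (θ' ∘ σ)`. -/
lemma twoFormAt_push (F : LineBundleIso L L') {θ : OneForm L} {θ' : OneForm L'}
    (h : ∀ x w, F.fibre x (θ.toFun x w) = θ'.toFun (F.base x) (F.base.d x w)) (x : M)
    (δ ε : GaugeFibre L x) :
    θ'.twoFormAt (F.base x) (F.push x δ) (F.push x ε) = F.fibre x (θ.twoFormAt x δ ε) := by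
  obtain ⟨D, rfl⟩ := exists_LDer_at δ
  obtain ⟨E, rfl⟩ := exists_LDer_at ε
  have h1 : ∀ X, F.pullback (θ'.eval (F.base.pushField X)) = θ.eval X := fun X => by
    ext y
    refine (F.fibre y).injective ?_
    rw [F.pullback_apply, OneForm.eval_apply, Diffeo.pushField_apply, OneForm.eval_apply, h]
  rw [← F.pushDer_at, ← F.pushDer_at, θ'.twoFormAt_at, θ.twoFormAt_at, θ.dD_apply, θ'.dD_apply,
    θ.lie_apply, θ'.lie_apply, F.pushDer_op, F.pushDer_op, F.pushDer_sym, F.pushDer_sym, h1, h1,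
    Diffeo.vbracket_pushField, ← h, map_sub, map_sub]

end LineBundleIso

/-! ### Isomorphisms covering a contactomorphism -/

section Lift

variable {M M' : SmoothManifold.{u}} {L : LineBundle.{u, v} M} {L' : LineBundle.{u, v} M'}

/-- As `f` and `g ∘ A` have the same kernel, `g ∘ A` factors through `f` by an injective map, and an
injective map between lines is an isomorphism. -/
lemma exists_linearEquiv_of_ker {V V' W W' : Type*} [AddCommGroup V] [Module ℝ V]
    [AddCommGroup V'] [Module ℝ V'] [AddCommGroup W] [Module ℝ W] [AddCommGroup W'] [Module ℝ W']
    (hW : Module.finrank ℝ W = 1) (hW' : Module.finrank ℝ W' = 1) {f : V →ₗ[ℝ] W}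
    (hf : Function.Surjective f) (g : V' →ₗ[ℝ] W') (A : V →ₗ[ℝ] V')
    (h : ∀ w, g (A w) = 0 ↔ f w = 0) : ∃ F : W ≃ₗ[ℝ] W', ∀ w, F (f w) = g (A w) := by
  have : FiniteDimensional ℝ W := Module.finite_of_finrank_eq_succ hW
  have : FiniteDimensional ℝ W' := Module.finite_of_finrank_eq_succ hW'
  obtain ⟨s, hs⟩ := LinearMap.exists_rightInverse_of_surjective f (LinearMap.range_eq_top.2 hf)
  have hs' : ∀ l, f (s l) = l := fun l => LinearMap.congr_fun hs l
  have hinj : Function.Injective (g.comp (A.comp s)) := by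
    rw [injective_iff_map_eq_zero]
    intro l hl
    rw [← hs' l]
    exact (h _).1 hl
  refine ⟨LinearEquiv.ofInjectiveOfFinrankEq (g.comp (A.comp s)) hinj (by rw [hW, hW']),
    fun w => ?_⟩
  change g (A (s (f w))) = g (A w)
  rw [← sub_eq_zero, ← map_sub, ← map_sub, h, map_sub, hs', sub_self]

/-- The map of total spaces of a family of maps compatible with 1-forms is smooth. -/
lemma contMDiff_total {θ : OneForm L} {θ' : OneForm L'}
    (hθ : ∀ x, Function.Surjective (θ.toFun x)) (φ : Diffeo M M')
    (F : ∀ x, L.fibre x ≃ₗ[ℝ] L'.fibre (φ x))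
    (h : ∀ x w, F x (θ.toFun x w) = θ'.toFun (φ x) (φ.d x w)) :
    ContMDiff ((𝓡 M.dim).prod 𝓘(ℝ, ℝ)) ((𝓡 M'.dim).prod 𝓘(ℝ, ℝ)) ∞
      (fun p : Bundle.TotalSpace ℝ L.fibre =>
        (⟨φ p.1, F p.1 p.2⟩ : Bundle.TotalSpace ℝ L'.fibre)) := by
  intro p
  obtain ⟨ψ, R, hR⟩ := θ.exists_dual (hθ p.1)
  let e := trivializationAt ℝ L.fibre p.1
  let e' := trivializationAt ℝ L'.fibre (φ p.1)
  have hp : p.1 ∈ e.baseSet := FiberBundle.mem_baseSet_trivializationAt' p.1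
  have hp' : φ p.1 ∈ e'.baseSet := FiberBundle.mem_baseSet_trivializationAt' _
  have hproj : ContMDiff ((𝓡 M.dim).prod 𝓘(ℝ, ℝ)) (𝓡 M.dim) ∞
      (fun q : Bundle.TotalSpace ℝ L.fibre => q.1) := Bundle.contMDiff_proj _
  have hφ : ContMDiff ((𝓡 M.dim).prod 𝓘(ℝ, ℝ)) (𝓡 M'.dim) ∞
      (fun q : Bundle.TotalSpace ℝ L.fibre => φ q.1) := φ.contMDiff.comp hproj
  rw [e'.contMDiffAt_iff (e'.mem_source.2 hp')]
  refine ⟨hφ p, ?_⟩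
  have h1 : ContMDiffAt ((𝓡 M.dim).prod 𝓘(ℝ, ℝ)) 𝓘(ℝ, ℝ) ∞ (fun q => (e q).2) p :=
    ((e.contMDiffAt_iff (f := id) (e.mem_source.2 hp)).1 contMDiffAt_id).2
  have h2 : ContMDiffAt ((𝓡 M.dim).prod 𝓘(ℝ, ℝ)) 𝓘(ℝ, ℝ) ∞
      (fun q : Bundle.TotalSpace ℝ L.fibre => (e ⟨q.1, θ.eval R q.1⟩).2) p :=
    ((e.contMDiffAt_section_iff hp).1 ((θ.eval R).contMDiff p.1)).comp p (hproj p)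
  have h3' : ContMDiffAt (𝓡 M'.dim) 𝓘(ℝ, ℝ) ∞
      (fun y => (e' ⟨y, θ'.eval (φ.pushField R) y⟩).2) (φ p.1) :=
    (e'.contMDiffAt_section_iff hp').1 ((θ'.eval (φ.pushField R)).contMDiff (φ p.1))
  have h3 : ContMDiffAt ((𝓡 M.dim).prod 𝓘(ℝ, ℝ)) 𝓘(ℝ, ℝ) ∞
      (fun q : Bundle.TotalSpace ℝ L.fibre =>
        (e' ⟨φ q.1, θ'.eval (φ.pushField R) (φ q.1)⟩).2) p :=
    ContMDiffAt.comp (g := fun y => (e' ⟨y, θ'.eval (φ.pushField R) y⟩).2) p h3' (hφ p)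
  have hne : (e ⟨p.1, θ.eval R p.1⟩).2 ≠ 0 := by
    intro h0
    have h4 : e.linearEquivAt ℝ p.1 hp (θ.eval R p.1) = 0 := h0
    rw [LinearEquiv.map_eq_zero_iff] at h4
    rw [← θ.eval_apply, h4, map_zero] at hR
    exact zero_ne_one hR
  -- Near `p` the section `θ(R)` frames `L`, and `F` sends it to the smooth section `θ'(φ_* R)`. In
  -- the trivializations, `F` therefore scales the latter by the coordinate of `q` relative to
  -- `θ(R)`.
  refine ((h1.mul (h2.inv₀ hne)).mul h3).congr_of_eventuallyEq ?_
  have hev1 : ∀ᶠ q : Bundle.TotalSpace ℝ L.fibre in nhds p, q.1 ∈ e.baseSet :=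
    hproj.continuous.continuousAt.eventually (e.open_baseSet.mem_nhds hp)
  have hev2 : ∀ᶠ q : Bundle.TotalSpace ℝ L.fibre in nhds p, φ q.1 ∈ e'.baseSet :=
    hφ.continuous.continuousAt.eventually (e'.open_baseSet.mem_nhds hp')
  have hev3 := h2.continuousAt.eventually_ne hne
  filter_upwards [hev1, hev2, hev3] with q hq hq' hq0
  have h5 : q.2 = ((e q).2 * (e ⟨q.1, θ.eval R q.1⟩).2⁻¹) • θ.eval R q.1 := by
    apply (e.linearEquivAt ℝ q.1 hq).injective
    rw [map_smul]
    change (e q).2 = _ * (e ⟨q.1, θ.eval R q.1⟩).2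
    rw [mul_assoc, inv_mul_cancel₀ hq0, mul_one]
  have h6 : F q.1 q.2 =
      ((e q).2 * (e ⟨q.1, θ.eval R q.1⟩).2⁻¹) • θ'.eval (φ.pushField R) (φ q.1) := by
    conv_lhs => rw [h5]
    rw [map_smul, θ.eval_apply, h, θ'.eval_apply, φ.pushField_apply]
  have h7 := (e'.linearEquivAt ℝ (φ q.1) hq').map_smul
    ((e q).2 * (e ⟨q.1, θ.eval R q.1⟩).2⁻¹) (θ'.eval (φ.pushField R) (φ q.1))
  rw [← h6] at h7
  exact h7

/-- A diffeomorphism identifying the kernels of `θ` and `θ'` lifts to an isomorphism of line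
bundles identifying `θ` and `θ'`. -/
lemma exists_lineBundleIso {θ : OneForm L} {θ' : OneForm L'}
    (hθ : ∀ x, Function.Surjective (θ.toFun x)) (hθ' : ∀ x, Function.Surjective (θ'.toFun x))
    (φ : Diffeo M M') (h : ∀ x w, θ'.toFun (φ x) (φ.d x w) = 0 ↔ θ.toFun x w = 0) :
    ∃ F : LineBundleIso L L', F.base = φ ∧
      ∀ x w, F.fibre x (θ.toFun x w) = θ'.toFun (F.base x) (F.base.d x w) := by
  have hsymm : ∀ y w, θ.toFun (φ.symm y) (Diffeo.d (φ.symm : Diffeo M' M) y w) = 0 ↔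
      θ'.toFun y w = 0 := fun y w => by
    rw [← h]
    have h1 := Diffeo.d_symm_d (φ.symm : Diffeo M' M) y w
    have h2 : ∀ p q : TangentBundle (𝓡 M'.dim) M', p = q →
      (θ'.toFun p.1 p.2 = 0 ↔ θ'.toFun q.1 q.2 = 0) := by
      rintro p _ rfl
      rfl
    exact h2 _ _ h1
  -- The inverse total map is built from `φ.symm` by the same recipe. That `F` and `G` are mutually
  -- inverse is checked on values of `θ` and `θ'`, where it reduces to the differentials being
  -- inverse.
  choose F hF using fun x => exists_linearEquiv_of_ker (L.finrank_fibre x)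
    (L'.finrank_fibre (φ x)) (hθ x) (θ'.toFun (φ x)) (φ.d x) (h x)
  choose G hG using fun y => exists_linearEquiv_of_ker (L'.finrank_fibre y)
    (L.finrank_fibre (φ.symm y)) (hθ' y) (θ.toFun (φ.symm y))
    (Diffeo.d (φ.symm : Diffeo M' M) y) (hsymm y)
  have hl : ∀ {N N' : SmoothManifold.{u}} {K : LineBundle.{u, v} N} (η : OneForm K)
      (p q : TangentBundle (𝓡 N.dim) N), p = q →
      (⟨p.1, η.toFun p.1 p.2⟩ : Bundle.TotalSpace ℝ K.fibre) = ⟨q.1, η.toFun q.1 q.2⟩ := by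
    rintro N N' K η p _ rfl
    rfl
  let total : Bundle.TotalSpace ℝ L.fibre ≃ₘ^∞⟮(𝓡 M.dim).prod 𝓘(ℝ, ℝ), (𝓡 M'.dim).prod 𝓘(ℝ, ℝ)⟯
      Bundle.TotalSpace ℝ L'.fibre :=
    { toFun := fun p => ⟨φ p.1, F p.1 p.2⟩
      invFun := fun p => ⟨φ.symm p.1, G p.1 p.2⟩
      left_inv := by
        rintro ⟨x, l⟩
        obtain ⟨w, rfl⟩ := hθ x l
        change (⟨φ.symm (φ x), G (φ x) (F x (θ.toFun x w))⟩ : Bundle.TotalSpace ℝ L.fibre) = _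
        rw [hF, hG]
        exact hl (N' := M) θ _ _ (φ.d_symm_d x w)
      right_inv := by
        rintro ⟨x, l⟩
        obtain ⟨w, rfl⟩ := hθ' x l
        change (⟨φ (φ.symm x), F (φ.symm x) (G x (θ'.toFun x w))⟩ :
          Bundle.TotalSpace ℝ L'.fibre) = _
        rw [hG, hF]
        exact hl (N' := M) θ' _ _ (Diffeo.d_symm_d (φ.symm : Diffeo M' M) x w)
      contMDiff_toFun := contMDiff_total hθ φ F hF
      contMDiff_invFun := contMDiff_total hθ' (φ.symm : Diffeo M' M) G hG }
  exact ⟨⟨φ, F, total, fun _ _ => rfl⟩, rfl, hF⟩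

end Lift

/-! ### The functor to contact manifolds -/

section Functor

lemma SymplecticAtiyahBundle.twoForm_oneForm (S : SymplecticAtiyahBundle.{u, v}) :
    S.form.oneForm.twoForm = S.form := (AtiyahTwoForm.eq_twoForm_oneForm S.isSymplectic.1).symm

lemma SymplecticAtiyahBundle.twoFormAt_oneForm (S : SymplecticAtiyahBundle.{u, v}) (x : S.M) :
    S.form.oneForm.twoFormAt x = S.form.toFun x :=
  congrArg (fun w : AtiyahTwoForm S.L => w.toFun x) S.twoForm_oneForm

/-- The induced map of gauge algebroids preserves `𝕀`, `ω` and symbols, hence also `θ`. -/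
lemma SymplecticAtiyahMorphism.fibre_oneForm {S S' : SymplecticAtiyahBundle.{u, v}}
    (F : SymplecticAtiyahMorphism S S') (x : S.M) (w : S.M.Tangent x) :
    F.fibre x (S.form.oneForm.toFun x w) =
      S'.form.oneForm.toFun (F.base x) (F.base.d x w) := by
  obtain ⟨ε, rfl⟩ := symbol_surjective S.L x w
  rw [S.form.oneForm_symbol, ← F.map_form, LineBundleIso.push_identityAt,
    ← S'.form.oneForm_symbol]
  rfl

/-- The functor `(L → M, ω) ↦ (M, ker θ)` with `θ ∘ σ = ι_𝕀 ω`. -/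
def toContact : SymplecticAtiyahBundle.{u, v} ⥤ ContactManifold.{u} where
  obj S := ⟨S.M, S.form.oneForm.ker, S.isSymplectic.isContact⟩
  map {S S'} F := ⟨F.base, fun x w => by
    change S'.form.oneForm.toFun (F.base x) (F.base.d x w) = 0 ↔ S.form.oneForm.toFun x w = 0
    rw [← SymplecticAtiyahMorphism.fibre_oneForm, LinearEquiv.map_eq_zero_iff]⟩

instance : (toContact.{u, v}).Faithful where
  map_injective {S S'} F F' h := by
    have hb : F.base = F'.base := congrArg Contactomorphism.base h
    have hF := F.fibre_oneForm
    have hF' := F'.fibre_oneForm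
    obtain ⟨⟨b, f, t, ht⟩, hm⟩ := F
    obtain ⟨⟨b', f', t', ht'⟩, hm'⟩ := F'
    dsimp only at hb
    subst hb
    have hf : f = f' := by
      funext x
      ext l
      obtain ⟨w, rfl⟩ := S.isSymplectic.oneForm_surjective x l
      exact (hF x w).trans (hF' x w).symm
    subst hf
    have hq : t = t' := by
      refine Diffeomorph.ext fun p => ?_
      exact (ht p.1 p.2).trans (ht' p.1 p.2).symm
    subst hq
    rfl

/-- Only the 1-forms have to be matched by the lift: both symplectic forms are their differentials,
which are natural. -/
instance : (toContact.{u, v}).Full where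
  map_surjective {S S'} c := by
    obtain ⟨F, hb, hF⟩ := exists_lineBundleIso S.isSymplectic.oneForm_surjective
      S'.isSymplectic.oneForm_surjective c.base c.mem_iff
    refine ⟨⟨F, fun x δ ε => ?_⟩, Contactomorphism.ext hb⟩
    rw [← S.twoFormAt_oneForm, ← S'.twoFormAt_oneForm]
    exact F.twoFormAt_push hF x δ ε

end Functor

/-! ### Local defining 1-forms of a distribution -/

section Defining

variable {M : SmoothManifold.{u}} {H : ∀ x : M, Submodule ℝ (M.Tangent x)}

lemma ne_top_of_finrank_quotient {V : Type*} [AddCommGroup V] [Module ℝ V] {P : Submodule ℝ V}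
    (h : Module.finrank ℝ (V ⧸ P) = 1) : P ≠ ⊤ := by
  rintro rfl
  rw [Module.finrank_zero_of_subsingleton] at h
  exact zero_ne_one h

lemma exists_notMem_of_finrank_quotient {V : Type*} [AddCommGroup V] [Module ℝ V]
    {P : Submodule ℝ V} (h : Module.finrank ℝ (V ⧸ P) = 1) : ∃ v, v ∉ P := by
  by_contra! h'
  exact ne_top_of_finrank_quotient h ((Submodule.eq_top_iff').2 h')

lemma IsHyperplaneDistribution.exists_fields (hH : IsHyperplaneDistribution H) (x : M) :
    ∃ (k : ℕ) (X : Fin k → M.VField),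
      ∀ᶠ y in nhds x, H y = Submodule.span ℝ (Set.range fun i => X i y) := by
  obtain ⟨U, hU, hx, k, X, hX, hs⟩ := hH.2 x
  obtain ⟨ρ, hρ, hsupp⟩ := SmoothManifold.exists_cutoff x (hU.mem_nhds hx)
  refine ⟨k, fun i => ⟨fun y => ρ y • X i y, ContMDiffOn.smul_section_of_tsupport (ψ := ρ)
    ρ.contMDiff.contMDiffOn hU hsupp (hX i)⟩, ?_⟩
  filter_upwards [hρ, hU.mem_nhds hx] with y hy hyU
  rw [hs y hyU]
  simp [hy]

/-- Because the `c j` separate vectors, relations among the rows of the matrix are exactly relations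
among the `W i`. -/
lemma linearIndependent_iff_det_ne_zero {ι V : Type*} [Fintype ι] [DecidableEq ι]
    [AddCommGroup V] [Module ℝ V] {c : ι → V →ₗ[ℝ] ℝ} (hc : ∀ v, (∀ j, c j v = 0) → v = 0)
    (W : ι → V) :
    (Matrix.of fun i j => c j (W i)).det ≠ 0 ↔ LinearIndependent ℝ W := by
  have key : ∀ a : ι → ℝ, Matrix.vecMul a (Matrix.of fun i j => c j (W i)) = 0 ↔
      ∑ i, a i • W i = 0 := fun a => by
    constructor
    · intro h
      refine hc _ fun j => ?_
      have := congrFun h j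
      simpa [Matrix.vecMul, dotProduct, map_sum] using this
    · intro h
      funext j
      have := congrArg (c j) h
      simpa [Matrix.vecMul, dotProduct, map_sum] using this
  rw [Fintype.linearIndependent_iff, ← not_iff_not, not_not, ← Matrix.exists_vecMul_eq_zero_iff]
  constructor
  · rintro ⟨a, ha, h⟩ h'
    exact ha (funext (h' a ((key a).1 h)))
  · intro h
    push Not at h
    obtain ⟨a, ha, i, hi⟩ := h
    exact ⟨a, fun h0 => hi (congrFun h0 i), (key a).2 ha⟩

lemma ker_eq_of_le {V : Type*} [AddCommGroup V] [Module ℝ V] {P : Submodule ℝ V} (hP : P ≠ ⊤)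
    {f : V →ₗ[ℝ] ℝ} (h : LinearMap.ker f ≤ P) : LinearMap.ker f = P := by
  refine le_antisymm h fun p hp => ?_
  by_contra hfp
  refine hP ((Submodule.eq_top_iff').2 fun v => ?_)
  have h1 : v - (f v / f p) • p ∈ P := h (by
    rw [LinearMap.mem_ker, map_sub, map_smul, smul_eq_mul, div_mul_cancel₀ _ hfp, sub_self])
  have := P.add_mem h1 (P.smul_mem (f v / f p) hp)
  rwa [sub_add_cancel] at this

/-- A subset of a family spanning a hyperplane `P`, together with a vector outside `P`, forms a
basis. -/
lemma exists_adapted_basis {V : Type*} [AddCommGroup V] [Module ℝ V] {P : Submodule ℝ V}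
    (hP : Module.finrank ℝ (V ⧸ P) = 1) {k : ℕ} {X : Fin k → V}
    (hX : P = Submodule.span ℝ (Set.range X)) {r : V} (hr : r ∉ P) :
    ∃ (J : Set V) (_ : Finite J) (s : J → Fin k) (B : Module.Basis (Option J) ℝ V),
      B none = r ∧ ∀ i, B (some i) = X (s i) := by
  obtain ⟨J, hJ, hspan, hli⟩ := exists_linearIndependent ℝ (Set.range X)
  have hs : ∀ j : J, ∃ i, X i = j := fun j => hJ j.2
  choose s hs using hs
  have hfin : Finite J := (Set.finite_range X).subset hJ
  have hspan' : Submodule.span ℝ (Set.range (Subtype.val : J → V)) = P := by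
    rw [Subtype.range_coe, hspan, hX]
  have hli' := linearIndependent_option'.2 ⟨hli, by rwa [hspan']⟩
  have htop : ⊤ ≤ Submodule.span ℝ
      (Set.range fun o : Option J => (o.casesOn' r Subtype.val : V)) := by
    intro v _
    have hle : P ≤ Submodule.span ℝ
        (Set.range fun o : Option J => (o.casesOn' r Subtype.val : V)) := by
      rw [← hspan', Submodule.span_le]
      rintro _ ⟨j, rfl⟩
      exact Submodule.subset_span ⟨some j, rfl⟩
    have hr0 : P.mkQ r ≠ 0 := by
      rwa [Submodule.mkQ_apply, Ne, Submodule.Quotient.mk_eq_zero]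
    obtain ⟨c, hc⟩ := (finrank_eq_one_iff_of_nonzero' _ hr0).1 hP (P.mkQ v)
    have h1 : v - c • r ∈ P := by
      rw [← Submodule.Quotient.mk_eq_zero, ← Submodule.mkQ_apply, map_sub, map_smul, hc, sub_self]
    have h2 := Submodule.add_mem _ (hle h1)
      (Submodule.smul_mem _ c (Submodule.subset_span ⟨none, rfl⟩))
    have h3 : v - c • r + c • r = v := sub_add_cancel _ _
    exact h3 ▸ h2
  refine ⟨J, hfin, s, Module.Basis.mk hli' htop, ?_, fun i => ?_⟩
  · rw [Module.Basis.mk_apply]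
    rfl
  · rw [Module.Basis.mk_apply, hs]
    rfl

/-- Take for `α(w)` the determinant, in a frame, of `w` together with fields forming a basis of `H`
at `x`. Where `α(R) ≠ 0` those fields stay independent, so `α(w) = 0` puts `w` in their span, inside
`H`; properness of `H` then forces `ker α = H`. -/
lemma IsHyperplaneDistribution.exists_covector (hH : IsHyperplaneDistribution H) (x : M) :
    ∃ α : ∀ y, M.Tangent y →ₗ[ℝ] ℝ,
      (∀ X : M.VField, ContMDiff (𝓡 M.dim) 𝓘(ℝ, ℝ) ∞ fun y => α y (X y)) ∧
      ∀ᶠ y in nhds x, LinearMap.ker (α y) = H y := by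
  classical
  obtain ⟨k, X, hX⟩ := hH.exists_fields x
  obtain ⟨r, hr⟩ := exists_notMem_of_finrank_quotient (hH.1 x)
  obtain ⟨J, hJ, s, B, hB0, hB⟩ := exists_adapted_basis (hH.1 x) hX.self_of_nhds hr
  obtain ⟨R, rfl⟩ := SmoothManifold.exists_vfield x r
  have := Fintype.ofFinite J
  -- The model basis is indexed by `Option J` so that the coordinate matrix is square with a
  -- distinguished row `none` for the argument of `α`.
  obtain ⟨E, c, η, hη, hcs, hc⟩ := exists_frame (M := M) (V := M.Tangent)
    (show Module.Basis (Option J) ℝ (EuclideanSpace ℝ (Fin M.dim)) from B) x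
  let m : ∀ y : M, M.Tangent y → Option J → M.Tangent y := fun y w o => o.elim w fun j => X (s j) y
  let α : ∀ y, M.Tangent y →ₗ[ℝ] ℝ := fun y =>
    ((Matrix.detRowAlternating (n := Option J) (R := ℝ)).toMultilinearMap.toLinearMap
      (fun i j => c j y (m y 0 i)) none).comp (LinearMap.pi fun j => c j y)
  have hα : ∀ y w, α y w = (Matrix.of fun i j => c j y (m y w i)).det := fun y w => by
    have h : Function.update (fun i j => c j y (m y 0 i)) none (fun j => c j y w) =
        fun i j => c j y (m y w i) := by
      funext i
      cases i with
      | none => rw [Function.update_self]; rfl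
      | some i => rw [Function.update_of_ne (by simp)]; rfl
    exact congrArg (Matrix.detRowAlternating (n := Option J) (R := ℝ)) h
  have hsm : ∀ Y : M.VField, ContMDiff (𝓡 M.dim) 𝓘(ℝ, ℝ) ∞ fun y => α y (Y y) := fun Y => by
    simp only [hα, Matrix.det_apply', Matrix.of_apply]
    refine contMDiff_finsetSum fun σ _ => ContMDiff.mul
      (f := fun _ => ((Equiv.Perm.sign σ : ℤ) : ℝ)) contMDiff_const
      (contMDiff_finsetProd fun i _ => ?_)
    cases σ i with
    | none => exact hcs i Y
    | some j => exact hcs i (X (s j))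
  refine ⟨α, hsm, ?_⟩
  have hinj : ∀ y, η y = 1 → ∀ w, (∀ j, c j y w = 0) → w = 0 := fun y hy w hw => by
    have := hc y w
    rw [hy, one_smul] at this
    rw [← this]
    exact Finset.sum_eq_zero fun j _ => by rw [hw, zero_smul]
  have hmx : m x (R x) = B := funext fun o => by
    cases o with
    | none => exact hB0.symm
    | some j => exact (hB j).symm
  have hx0 : α x (R x) ≠ 0 := by
    rw [hα, linearIndependent_iff_det_ne_zero (hinj x hη.self_of_nhds), hmx]
    exact B.linearIndependent
  filter_upwards [hη, hX, (hsm R).continuous.continuousAt.eventually_ne hx0] with y hy hXy hRy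
  refine ker_eq_of_le (ne_top_of_finrank_quotient (hH.1 y)) fun w hw => ?_
  rw [hα, linearIndependent_iff_det_ne_zero (hinj y hy), linearIndependent_option] at hRy
  have hw' : ¬ LinearIndependent ℝ (m y w) := by
    rw [← linearIndependent_iff_det_ne_zero (hinj y hy), ← hα, not_not]
    exact hw
  rw [linearIndependent_option, not_and, not_not] at hw'
  have h := hw' hRy.1
  rw [hXy]
  refine Submodule.span_mono ?_ h
  rintro _ ⟨j, rfl⟩
  exact ⟨s j, rfl⟩

end Defining

/-! ### The normal line bundle of a hyperplane distribution -/

/-- 1-forms `α i` on `M` with kernel `H` on open sets `U i` covering `M`. -/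
structure DefiningForms {M : SmoothManifold.{u}} (H : ∀ x : M, Submodule ℝ (M.Tangent x)) where
  α : M → ∀ y, M.Tangent y →ₗ[ℝ] ℝ
  smooth : ∀ i (X : M.VField), ContMDiff (𝓡 M.dim) 𝓘(ℝ, ℝ) ∞ fun y => α i y (X y)
  U : M → Set M
  isOpen : ∀ i, IsOpen (U i)
  mem : ∀ i, i ∈ U i
  ker_eq : ∀ i, ∀ y ∈ U i, LinearMap.ker (α i y) = H y
  notMem : ∀ y, ∃ w, w ∉ H y

namespace DefiningForms

variable {M : SmoothManifold.{u}} {H : ∀ x : M, Submodule ℝ (M.Tangent x)} (A : DefiningForms H)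

lemma nonempty (hH : IsHyperplaneDistribution H) : Nonempty (DefiningForms H) := by
  choose α hα hker using hH.exists_covector
  choose U hU hUo hmem using fun x => eventually_nhds_iff.1 (hker x)
  exact ⟨⟨α, hα, U, hUo, hmem, hU, fun y => exists_notMem_of_finrank_quotient (hH.1 y)⟩⟩

/-- The fibre of the normal bundle at `x`, trivialized by the form `α x`. -/
def Fibre (_ : DefiningForms H) (_ : M) : Type v := ULift.{v} ℝ

instance (x : M) : AddCommGroup (A.Fibre x) := inferInstanceAs (AddCommGroup (ULift.{v} ℝ))

instance (x : M) : Module ℝ (A.Fibre x) := inferInstanceAs (Module ℝ (ULift.{v} ℝ))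

instance (x : M) : TopologicalSpace (A.Fibre x) :=
  inferInstanceAs (TopologicalSpace (ULift.{v} ℝ))

lemma apply_ne_zero {i y : M} (hy : y ∈ A.U i) {w : M.Tangent y} (hw : w ∉ H y) :
    A.α i y w ≠ 0 := by
  rwa [← A.ker_eq i y hy] at hw

/-- The factor with `α i = g i • α y` at `y`. -/
def g (i y : M) : ℝ := A.α i y (A.notMem y).choose / A.α y y (A.notMem y).choose

lemma g_ne_zero {i y : M} (hy : y ∈ A.U i) : A.g i y ≠ 0 :=
  div_ne_zero (A.apply_ne_zero hy (A.notMem y).choose_spec)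
    (A.apply_ne_zero (A.mem y) (A.notMem y).choose_spec)

lemma apply_eq {i y : M} (hy : y ∈ A.U i) (w : M.Tangent y) :
    A.α i y w = A.g i y * A.α y y w := by
  set r := (A.notMem y).choose
  have hr : A.α y y r ≠ 0 := A.apply_ne_zero (A.mem y) (A.notMem y).choose_spec
  have h : w - (A.α y y w / A.α y y r) • r ∈ H y := by
    rw [← A.ker_eq y y (A.mem y), LinearMap.mem_ker, map_sub, map_smul, smul_eq_mul,
      div_mul_cancel₀ _ hr, sub_self]
  rw [← A.ker_eq i y hy, LinearMap.mem_ker, map_sub, map_smul, smul_eq_mul, sub_eq_zero] at h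
  rw [h, g]
  ring

/-- The local trivialization by `α i`. -/
def pretriv (i : M) :
    Bundle.Pretrivialization ℝ (Bundle.TotalSpace.proj : Bundle.TotalSpace ℝ A.Fibre.{u, v} → M) where
  toFun p := (p.1, A.g i p.1 * ULift.down (p.2 : ULift.{v} ℝ))
  invFun q := ⟨q.1, (ULift.up ((A.g i q.1)⁻¹ * q.2) : ULift.{v} ℝ)⟩
  source := Bundle.TotalSpace.proj ⁻¹' A.U i
  target := A.U i ×ˢ Set.univ
  map_source' p hp := ⟨hp, trivial⟩
  map_target' q hq := hq.1
  left_inv' := by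
    rintro ⟨y, t⟩ hp
    refine congrArg (Bundle.TotalSpace.mk y) (ULift.down_injective ?_)
    exact inv_mul_cancel_left₀ (A.g_ne_zero hp) _
  right_inv' := by
    rintro ⟨y, t⟩ hq
    exact congrArg (Prod.mk y) (mul_inv_cancel_left₀ (A.g_ne_zero hq.1) _)
  open_target := (A.isOpen i).prod isOpen_univ
  baseSet := A.U i
  open_baseSet := A.isOpen i
  source_eq := rfl
  target_eq := rfl
  proj_toFun _ _ := rfl

instance (i : M) : (A.pretriv.{u, v} i).IsLinear ℝ where
  linear y _ :=
    { map_add := fun a b => mul_add (A.g i y) (ULift.down (a : ULift.{v} ℝ)) (ULift.down b)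
      map_smul := fun c a => mul_left_comm (A.g i y) c (ULift.down (a : ULift.{v} ℝ)) }

/-- The coordinate changes. -/
def coordChange (i j y : M) : ℝ →L[ℝ] ℝ := (A.g j y * (A.g i y)⁻¹) • ContinuousLinearMap.id ℝ ℝ

lemma coordChange_apply {i j y : M} (hy : y ∈ A.U i) (t : ℝ) :
    A.coordChange i j y t = (A.pretriv.{u, v} j ⟨y, (A.pretriv.{u, v} i).symm y t⟩).2 := by
  rw [Bundle.Pretrivialization.symm_apply _ hy]
  exact mul_assoc _ _ _

/-- The factors `g` involve arbitrary choices at each point and need not be smooth, but the quotient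
of two of them is `α j (R) / α i (R)` for any field `R` transverse to `H`. -/
lemma contMDiffOn_coordChange (i j : M) :
    ContMDiffOn (𝓡 M.dim) 𝓘(ℝ, ℝ →L[ℝ] ℝ) ∞ (A.coordChange i j) (A.U i ∩ A.U j) := by
  intro x hx
  obtain ⟨w, hw⟩ := A.notMem x
  obtain ⟨R, rfl⟩ := SmoothManifold.exists_vfield x w
  have hi := A.apply_ne_zero hx.1 hw
  have hj := A.apply_ne_zero hx.2 hw
  have h : ContMDiffAt (𝓡 M.dim) 𝓘(ℝ, ℝ) ∞
      (fun y => A.α j y (R y) * (A.α i y (R y))⁻¹) x :=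
    (A.smooth j R x).mul ((A.smooth i R x).inv₀ hi)
  refine ((h.smul (contMDiffAt_const (c := ContinuousLinearMap.id ℝ ℝ))).congr_of_eventuallyEq
    ?_).contMDiffWithinAt
  filter_upwards [(A.isOpen i).mem_nhds hx.1, (A.isOpen j).mem_nhds hx.2,
    (A.smooth i R).continuous.continuousAt.eventually_ne hi] with y hyi hyj hne
  have h0 : A.α y y (R y) ≠ 0 := by
    intro h0
    rw [A.apply_eq hyi, h0, mul_zero] at hne
    exact hne rfl
  have h1 := A.g_ne_zero hyi
  have h2 : A.g j y * (A.g i y)⁻¹ = A.α j y (R y) * (A.α i y (R y))⁻¹ := by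
    rw [A.apply_eq hyi, A.apply_eq hyj]
    field_simp
  exact congrArg (fun a : ℝ => a • ContinuousLinearMap.id ℝ ℝ) h2

/-- The structure of a vector bundle. -/
def prebundle : VectorPrebundle ℝ ℝ A.Fibre.{u, v} where
  pretrivializationAtlas := Set.range A.pretriv
  pretrivialization_linear' := by
    rintro _ ⟨i, rfl⟩
    infer_instance
  pretrivializationAt := A.pretriv
  mem_base_pretrivializationAt := A.mem
  pretrivialization_mem_atlas i := ⟨i, rfl⟩
  exists_coordChange := by
    rintro _ ⟨i, rfl⟩ _ ⟨j, rfl⟩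
    exact ⟨A.coordChange i j, (A.contMDiffOn_coordChange i j).continuousOn,
      fun y hy t => A.coordChange_apply hy.1 t⟩
  totalSpaceMk_isInducing x :=
    Topology.isInducing_const_prod.2
      ((Homeomorph.ulift.trans (Homeomorph.mulLeft₀ _ (A.g_ne_zero (A.mem x)))).isInducing)

instance : (A.prebundle.{u, v}).IsContMDiff (𝓡 M.dim) ∞ where
  exists_contMDiffCoordChange := by
    rintro _ ⟨i, rfl⟩ _ ⟨j, rfl⟩
    exact ⟨A.coordChange i j, A.contMDiffOn_coordChange i j,
      fun y hy t => A.coordChange_apply hy.1 t⟩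

/-- The normal line bundle. -/
def bundle : LineBundle.{u, v} M :=
  letI := A.prebundle.{u, v}.totalSpaceTopology
  letI := A.prebundle.{u, v}.toFiberBundle
  haveI := A.prebundle.{u, v}.toVectorBundle
  haveI := A.prebundle.{u, v}.contMDiffVectorBundle (n := ∞) (𝓡 M.dim)
  { fibre := A.Fibre.{u, v} }

/-- The projection to the normal line bundle. -/
def proj : OneForm A.bundle.{u, v} where
  toFun y := (ULift.moduleEquiv (R := ℝ) (M := ℝ)).symm.toLinearMap.comp (A.α y y)
  smooth X x := by
    have hx : x ∈ (trivializationAt ℝ A.bundle.{u, v}.fibre x).baseSet := A.mem x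
    refine ((trivializationAt ℝ A.bundle.{u, v}.fibre x).contMDiffAt_section_iff hx).2 ?_
    refine (A.smooth x X x).congr_of_eventuallyEq ?_
    -- In the trivialization at `x` the projection reads `g x y * α y y = α x y`, which is smooth
    -- although `y ↦ α y y` need not be.
    filter_upwards [(A.isOpen x).mem_nhds (A.mem x)] with y hy
    exact (A.apply_eq hy (X y)).symm

lemma proj_eq_zero_iff (x : M) (w : M.Tangent x) : A.proj.{u, v}.toFun x w = 0 ↔ w ∈ H x := by
  rw [← A.ker_eq x x (A.mem x), LinearMap.mem_ker]
  exact (ULift.moduleEquiv (R := ℝ) (M := ℝ)).symm.map_eq_zero_iff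

end DefiningForms

/-- Every hyperplane distribution is the kernel of a surjective 1-form with values in a line
bundle. -/
lemma IsHyperplaneDistribution.exists_oneForm {M : SmoothManifold.{u}}
    {H : ∀ x : M, Submodule ℝ (M.Tangent x)} (hH : IsHyperplaneDistribution H) :
    ∃ (L : LineBundle.{u, v} M) (θ : OneForm L),
      (∀ x, Function.Surjective (θ.toFun x)) ∧ θ.ker = H := by
  obtain ⟨A⟩ := DefiningForms.nonempty hH
  refine ⟨A.bundle, A.proj, fun x => ?_, funext fun x => Submodule.ext fun w =>
    A.proj_eq_zero_iff x w⟩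
  obtain ⟨w, hw⟩ := A.notMem x
  exact A.proj.surjective_of_ne_zero fun h => hw ((A.proj_eq_zero_iff x w).1 h)

/-! ### The equivalence -/

/-- The object is hit on the nose: `θ` is recovered from `d_D (θ ∘ σ)`, so its kernel is the
original distribution. -/
instance : (toContact.{u, v}).EssSurj where
  mem_essImage C := by
    obtain ⟨L, θ, hθ, hker⟩ := IsHyperplaneDistribution.exists_oneForm.{u, v} C.isContact.1
    have hc : IsContact θ.ker := hker ▸ C.isContact
    let S : SymplecticAtiyahBundle.{u, v} := ⟨C.M, L, θ.twoForm, (θ.isContact_iff hθ).1 hc⟩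
    have hS : toContact.obj S = C := by
      have h : θ.twoForm.oneForm.ker = C.H := by rw [θ.twoForm_oneForm, hker]
      change ContactManifold.mk C.M θ.twoForm.oneForm.ker _ = ContactManifold.mk C.M C.H _
      congr
    exact ⟨S, ⟨eqToIso hS⟩⟩

instance : (toContact.{u, v}).IsEquivalence where

end AtiyahContact

end

open AtiyahContact CategoryTheory

universe u v

theorem theorem4p1 :
    ∃ e : ContactManifold.{u} ≌ SymplecticAtiyahBundle.{u, v},
      -- from contact manifolds to symplectic Atiyah bundles: over the same base (up to the natural
      -- identification `φ`), `θ C` identifies `L` with `TM/H`, and `ω = d_D (θ ∘ σ)`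
      (∃ (φ : ∀ C : ContactManifold.{u}, Diffeo C.M (e.functor.obj C).M)
          (θ : ∀ C : ContactManifold.{u}, OneForm (e.functor.obj C).L),
        (∀ (C C' : ContactManifold.{u}) (f : C ⟶ C') (x : C.M),
          (e.functor.map f).base (φ C x) = φ C' (f.base x)) ∧
        (∀ (C C' : ContactManifold.{u}) (f : C ⟶ C') (y : (e.functor.obj C).M)
            (w : (e.functor.obj C).M.Tangent y),
          (e.functor.map f).fibre y ((θ C).toFun y w) =
            (θ C').toFun ((e.functor.map f).base y) ((e.functor.map f).base.d y w)) ∧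
        (∀ (C : ContactManifold.{u}) (y : (e.functor.obj C).M),
          Function.Surjective ((θ C).toFun y)) ∧
        (∀ (C : ContactManifold.{u}) (x : C.M) (w : C.M.Tangent x),
          (θ C).toFun (φ C x) ((φ C).d x w) = 0 ↔ w ∈ C.H x) ∧
        (∀ (C : ContactManifold.{u}) (D₁ D₂ : LDer (e.functor.obj C).L),
          (e.functor.obj C).form.eval D₁ D₂ = (θ C).compSymbol.dD D₁ D₂)) ∧
      -- from symplectic Atiyah bundles to contact manifolds: over the same base (up to the natural
      -- identification `ψ`), `θ S` is the unique 1-form with `θ ∘ σ = ι_𝕀 ω`, one has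
      -- `ω = d_D (θ ∘ σ)`, and `H = ker θ`
      (∃ (ψ : ∀ S : SymplecticAtiyahBundle.{u, v}, Diffeo S.M (e.inverse.obj S).M)
          (θ : ∀ S : SymplecticAtiyahBundle.{u, v}, OneForm S.L),
        (∀ (S S' : SymplecticAtiyahBundle.{u, v}) (F : S ⟶ S') (x : S.M),
          (e.inverse.map F).base (ψ S x) = ψ S' (F.base x)) ∧
        (∀ (S : SymplecticAtiyahBundle.{u, v}) (η : OneForm S.L),
          η.compSymbol = S.form.interiorId ↔ η = θ S) ∧
        (∀ (S : SymplecticAtiyahBundle.{u, v}) (D₁ D₂ : LDer S.L),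
          S.form.eval D₁ D₂ = (θ S).compSymbol.dD D₁ D₂) ∧
        (∀ (S : SymplecticAtiyahBundle.{u, v}) (x : S.M) (w : S.M.Tangent x),
          (ψ S).d x w ∈ (e.inverse.obj S).H (ψ S x) ↔ (θ S).toFun x w = 0)) := by
  let E := (toContact.{u, v}).asEquivalence
  -- The functor out of contact manifolds is an abstract quasi-inverse of `toContact`, so its base
  -- manifold agrees with the given one only up to the counit. In the other direction the base is
  -- literally unchanged and `ψ` is the identity.
  let φ : ∀ C : ContactManifold.{u}, Contactomorphism C (toContact.obj (E.inverse.obj C)) :=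
    fun C => E.counitIso.inv.app C
  refine ⟨E.symm,
    ⟨fun C => (φ C).base, fun C => (E.inverse.obj C).form.oneForm, fun C C' f x => ?_,
      fun C C' f y w => SymplecticAtiyahMorphism.fibre_oneForm (E.inverse.map f) y w,
      fun C y => (E.inverse.obj C).isSymplectic.oneForm_surjective y,
      fun C x w => (φ C).mem_iff x w,
      fun C D₁ D₂ =>
        AtiyahTwoForm.eval_eq_dD_oneForm (E.inverse.obj C).isSymplectic.1 D₁ D₂⟩,
    ⟨fun S => Diffeomorph.refl _ _ _, fun S => S.form.oneForm, fun S S' F x => rfl,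
      fun S η => S.form.compSymbol_eq_interiorId_iff η,
      fun S D₁ D₂ => AtiyahTwoForm.eval_eq_dD_oneForm S.isSymplectic.1 D₁ D₂,
      fun S x w => ?_⟩⟩
  · have h := E.counitIso.inv.naturality f
    exact (congrArg (fun c : Contactomorphism C (toContact.obj (E.inverse.obj C')) => c.base x)
      h).symm
  · have h := Diffeo.d_refl x w
    change Diffeo.d (Diffeomorph.refl (𝓡 S.M.dim) S.M ∞ : Diffeo S.M S.M) x w ∈
      S.form.oneForm.ker x ↔ _
    rw [h]
    rfl
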